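/- **Setting.** Let $d\in\{1,2\}$, let $\Omega\subset\mathbb R^d$ be a bounded open set, $T>0$, $\alpha\in(0,1)$, $\sigma=\alpha/2$, $r\ge 1$. Write $(\cdot,\cdot)$, $\|\cdot\|$ for the inner product and norm of $L^2(\Omega)$ and $l(u)=\int_\Omega u\,dx$. Let $a:\mathbb R\to\mathbb R$ satisfy $0<m_1\le a(x)\le m_2$ and $|a(x)-a(y)|\le L|x-y|$ for all $x,y\in\mathbb R$, and let $f(t)\in L^2(\Omega)$ for each $t$. *Space.* Let $\mathcal T_h$ be a finite conforming partition into intervals ($d=1$) or triangles ($d=2$) of a set $\overline{\Omega}_h\subseteq\overline\Omega$ (all of $\overline\Omega$, or an inscribed polygon when $\Omega$ is curved), and let $V_h$ be the space of continuous functions that are affine on each element of $\mathcal T_h$ and vanish outside $\Omega$ and outside $\overline{\Omega}_h$. *Time.* For $N\in\mathbb N$ let $t_n=T(n/N)^r$ ($0\le n\le N$), $\tau_n=t_n-t_{n-1}$, $t_{n-\sigma}=(1-\sigma)t_n+\sigma t_{n-1}$, $t_{j-1/2}=\frac12(t_{j-1}+t_j)$, $U^{n,\sigma}=(1-\sigma)U^n+\sigma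 U^{n-1}$. Put $$a_{n,n}=\tfrac1{\Gamma(1-\alpha)}\int_{t_{n-1}}^{t_{n-\sigma}}(t_{n-\sigma}-\eta)^{-\alpha}d\eta,\qquad a_{n,j}=\tfrac1{\Gamma(1-\alpha)}\int_{t_{j-1}}^{t_j}(t_{n-\sigma}-\eta)^{-\alpha}d\eta\quad(1\le j\le n-1),$$ $$b_{n,j}=\tfrac{2}{\Gamma(1-\alpha)(t_{j+1}-t_{j-1})}\int_{t_{j-1}}^{t_j}(t_{n-\sigma}-\eta)^{-\alpha}(\eta-t_{j-1/2})\,d\eta\quad(1\le j\le n-1),\qquad b_{n,0}=0,$$ $g_{1,1}=\tau_1^{-1}a_{1,1}$ and, for $n\ge2$, $g_{n,1}=\tau_1^{-1}(a_{n,1}-b_{n,1})$, $g_{n,j}=\tau_j^{-1}(a_{n,j}+b_{n,j-1}-b_{n,j})$ for $2\le j\le n-1$, $g_{n,n}=\tau_n^{-1}(a_{n,n}+b_{n,n-1})$. Let $D^\alpha_NU^{n-\sigma}=\sum_{j=1}^n g_{n,j}(U^j-U^{j-1})$. *Scheme.* Given $U^0\in V_h$, for $n=1,\dots,N$ find $U^n\in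 V_h$ such that $$(D^\alpha_NU^{n-\sigma},v_h)+a\big(l(U^{n,\sigma})\big)(\nabla U^{n,\sigma},\nabla v_h)=(f(t_{n-\sigma}),v_h)\qquad\forall v_h\in V_h.\tag{S$_n$}$$ **Theorem.** For all $\Omega,T,\alpha,r,m_1$ and every $F$ there is a constant $C>0$, depending only on these (in particular not on $\mathcal T_h$, $h$, $N$, $n$, $U^0$, $L$, $m_2$), with the following property for all $a,f,\mathcal T_h,N$ as above. Let $1\le n\le N$, suppose $\|f(t_{j-\sigma})\|\le F$ for $1\le j\le n$, and let $U^0,\dots,U^{n-1}\in V_h$ be given such that (S$_j$) holds for $1\le j\le n-1$. If $$\tau_n\le\tau:=\frac{2m_1\,(a_{n,n}+b_{n,n-1})}{(1-\sigma)\{L\,C\,R_1(1-2\sigma)\}^2},\qquad R_1=C(1+\|\nabla U^0\|)$$ (with $\tau=\infty$ if $L=0$; in particular, if $\max_{1\le j\le N}\tau_j\le\tau$), then there is exactly one $U^n\in V_h$ satisfying (S$_n$). -/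

import Mathlib

open MeasureTheory
open scoped ENNReal

noncomputable section

namespace NonlocalDiffusion

/-- The Euclidean space `ℝ^d`. -/
abbrev Space (d : ℕ) := EuclideanSpace ℝ (Fin d)

/-! ### The finite element space -/

/-- A finite conforming partition into closed nondegenerate `d`-simplices (intervals for `d = 1`,
triangles for `d = 2`) of a region `Ω_h ⊆ closure Ω`. The region is the underlying space of the
simplicial complex; it may be all of `closure Ω`, or, when a curved `Ω` cannot be triangulated
exactly, an inscribed polygon. -/
structure Mesh {d : ℕ} (Ω : Set (Space d)) where
  complex : Geometry.SimplicialComplex ℝ (Space d)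
  finite : complex.faces.Finite
  pure : ∀ s ∈ complex.faces, ∃ t ∈ complex.faces, s ⊆ t ∧ t.card = d + 1
  space_subset : complex.space ⊆ closure Ω

/-- The finite element space `V_h`: continuous functions that are affine on every element of the
mesh and vanish outside `Ω` and outside `Ω_h` (hence, by continuity, on the boundary). Elements of
`V_h` are represented by their continuous extensions by zero to `ℝ^d`. -/
def feSpace {d : ℕ} {Ω : Set (Space d)} (K : Mesh Ω) : Submodule ℝ (Space d → ℝ) where
  carrier := {u | Continuous u ∧ (∀ x, x ∉ Ω → u x = 0) ∧ (∀ x, x ∉ K.complex.space → u x = 0) ∧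
    ∀ s ∈ K.complex.faces, s.card = d + 1 →
      ∃ A : Space d →ᵃ[ℝ] ℝ, Set.EqOn u A (convexHull ℝ (s : Set (Space d)))}
  zero_mem' := by
    refine ⟨continuous_zero, fun _ _ => rfl, fun _ _ => rfl, fun s _ _ => ⟨0, fun x _ => rfl⟩⟩
  add_mem' := by
    rintro u v ⟨hu, hu1, hu2, hu3⟩ ⟨hv, hv1, hv2, hv3⟩
    refine ⟨hu.add hv, fun x hx => by simp [hu1 x hx, hv1 x hx],
      fun x hx => by simp [hu2 x hx, hv2 x hx], fun s hs hc => ?_⟩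
    obtain ⟨A, hA⟩ := hu3 s hs hc
    obtain ⟨B, hB⟩ := hv3 s hs hc
    exact ⟨A + B, fun x hx => by simp [hA hx, hB hx]⟩
  smul_mem' := by
    rintro c u ⟨hu, hu1, hu2, hu3⟩
    refine ⟨hu.const_smul c, fun x hx => by simp [hu1 x hx],
      fun x hx => by simp [hu2 x hx], fun s hs hc => ?_⟩
    obtain ⟨A, hA⟩ := hu3 s hs hc
    exact ⟨c • A, fun x hx => by simp [hA hx]⟩

/-- `(u, v)`, the inner product of `L²(Ω)`. -/
def l2Inner {d : ℕ} (Ω : Set (Space d)) (u v : Space d → ℝ) : ℝ :=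
  ∫ x in Ω, u x * v x

/-- `(∇u, ∇v)`. A function in `V_h` is differentiable off the skeleton of the mesh, which is a
null set, and its weak gradient is its pointwise gradient. -/
def gradInner {d : ℕ} (Ω : Set (Space d)) (u v : Space d → ℝ) : ℝ :=
  ∫ x in Ω, inner ℝ (gradient u x) (gradient v x)

/-- `‖∇u‖` in `L²(Ω)`. -/
def gradNorm {d : ℕ} (Ω : Set (Space d)) (u : Space d → ℝ) : ℝ :=
  Real.sqrt (gradInner Ω u u)

/-- `l(u) = ∫_Ω u`. -/
def totalMass {d : ℕ} (Ω : Set (Space d)) (u : Space d → ℝ) : ℝ :=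
  ∫ x in Ω, u x

/-! ### The graded temporal mesh and the `L2-1_σ` coefficients -/

/-- `t_n = T (n / N) ^ r`. -/
def gridTime (T r : ℝ) (N n : ℕ) : ℝ := T * ((n : ℝ) / (N : ℝ)) ^ r

/-- `τ_n = t_n - t_{n-1}`, for `n ≥ 1`. -/
def timeStep (T r : ℝ) (N n : ℕ) : ℝ := gridTime T r N n - gridTime T r N (n - 1)

/-- `t_{n-σ} = (1 - σ) t_n + σ t_{n-1}` with `σ = α / 2`, for `n ≥ 1`. -/
def offsetTime (T r α : ℝ) (N n : ℕ) : ℝ :=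
  (1 - α / 2) * gridTime T r N n + α / 2 * gridTime T r N (n - 1)

/-- The coefficients `a_{n,j}`, for `1 ≤ j ≤ n`. -/
def aCoeff (T r α : ℝ) (N n j : ℕ) : ℝ :=
  1 / Real.Gamma (1 - α) *
    ∫ η in (gridTime T r N (j - 1))..(if j = n then offsetTime T r α N n else gridTime T r N j),
      (offsetTime T r α N n - η) ^ (-α)

/-- The coefficients `b_{n,j}`, for `1 ≤ j ≤ n - 1`, where `t_{j-1/2}` is the midpoint of
`[t_{j-1}, t_j]`; by convention `b_{n,0} = 0`. -/
def bCoeff (T r α : ℝ) (N n j : ℕ) : ℝ :=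
  if j = 0 then 0 else
    2 / (Real.Gamma (1 - α) * (gridTime T r N (j + 1) - gridTime T r N (j - 1))) *
      ∫ η in (gridTime T r N (j - 1))..(gridTime T r N j),
        (offsetTime T r α N n - η) ^ (-α) *
          (η - (gridTime T r N (j - 1) + gridTime T r N j) / 2)

/-- The coefficients `g_{n,j}`, for `1 ≤ j ≤ n`. -/
def gCoeff (T r α : ℝ) (N n j : ℕ) : ℝ :=
  (timeStep T r N j)⁻¹ *
    (if n = 1 then aCoeff T r α N 1 1
     else if j = 1 then aCoeff T r α N n 1 - bCoeff T r α N n 1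
     else if j < n then aCoeff T r α N n j + bCoeff T r α N n (j - 1) - bCoeff T r α N n j
     else aCoeff T r α N n n + bCoeff T r α N n (n - 1))

/-- The discrete fractional derivative `D_N^α U^{n-σ} = ∑_{j=1}^n g_{n,j} (U^j - U^{j-1})`. -/
def discreteCaputo {d : ℕ} (T r α : ℝ) (N : ℕ) (U : ℕ → Space d → ℝ) (n : ℕ) : Space d → ℝ :=
  ∑ j ∈ Finset.Icc 1 n, gCoeff T r α N n j • (U j - U (j - 1))

/-- `U^{n,σ} = (1 - σ) U^n + σ U^{n-1}` with `σ = α / 2`, for `n ≥ 1`. -/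
def weightedLevel {d : ℕ} (α : ℝ) (U : ℕ → Space d → ℝ) (n : ℕ) : Space d → ℝ :=
  (1 - α / 2) • U n + (α / 2) • U (n - 1)

/-! ### The fully-discrete scheme -/

/-- The `n`-th equation of the scheme, for the time levels `U^0, …, U^n`: for all `v ∈ V_h`,
`(D_N^α U^{n-σ}, v) + a(l(U^{n,σ})) (∇U^{n,σ}, ∇v) = (f(t_{n-σ}), v)`. -/
def SchemeAt {d : ℕ} {Ω : Set (Space d)} (K : Mesh Ω) (T r α : ℝ) (N : ℕ) (a : ℝ → ℝ)
    (f : ℝ → Lp ℝ 2 (volume.restrict Ω)) (U : ℕ → Space d → ℝ) (n : ℕ) : Prop :=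
  ∀ v ∈ feSpace K,
    l2Inner Ω (discreteCaputo T r α N U n) v +
        a (totalMass Ω (weightedLevel α U n)) * gradInner Ω (weightedLevel α U n) v =
      l2Inner Ω (f (offsetTime T r α N n)) v

/-- The step-size threshold
`τ = 2 m₁ (a_{n,n} + b_{n,n-1}) / ((1 - σ) {L C R₁ (1 - 2σ)}²)` at level `n`, where
`R₁ = C (1 + ‖∇U^0‖)` and `σ = α / 2`. It takes values in `[0, ∞]`, so that `τ = ∞`
(no restriction) if `L = 0`. -/
def stepThreshold {d : ℕ} (Ω : Set (Space d)) (T r α : ℝ) (N : ℕ) (m₁ L C : ℝ)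
    (U₀ : Space d → ℝ) (n : ℕ) : ℝ≥0∞ :=
  ENNReal.ofReal (2 * m₁ * (aCoeff T r α N n n + bCoeff T r α N n (n - 1))) /
    ENNReal.ofReal
      ((1 - α / 2) * (L * C * (C * (1 + gradNorm Ω U₀)) * (1 - 2 * (α / 2))) ^ 2)

end NonlocalDiffusion

end

/-! In terms of $w=U^{n,\sigma}$, one step reads $\gamma(w,v)+a(l(w))(\nabla w,\nabla v)=\psi(v)$
with $\gamma=g_{n,n}/(1-\sigma)$. The nonlinearity enters only through the number $l(w)$.

Existence (`exists_nonlocal_solution`) needs no step restriction. Freeze the coefficient at $a(x)$,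
solve the linear problem for $w(x)$, and find a zero of $l(w(x))-x$ by the intermediate value
theorem.

Uniqueness (`nonlocal_solution_unique`) is an energy argument. The difference of two solutions
vanishes if $(L|\Omega|^{1/2}B)^2<4m_1\gamma$, where $B$ bounds the gradient of one of them. Because
$a_{n,n}+b_{n,n-1}=\tau_n g_{n,n}$, the step condition is exactly a bound of this kind once $C$ is
large.

The bound $B$ must not depend on $L$, $m_2$ or the meshes. It comes from stability in the gradient
norm (`norm_sq_map_le`): testing with the discrete Laplacian of $w$ leaves a right side controlled
by $F$ and $m_1$ alone, and Alikhanov's inequality (`half_sum_le_inner`) bounds the fractional term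
below. This uses $g_{n,j}\le g_{n,j+1}$, $(1-\sigma)^2g_{n,n-1}\le(1-2\sigma)g_{n,n}$ and
$g_{n,1}\ge T^{-\alpha}/\Gamma(1-\alpha)$. All three follow by comparing $g_{n,j}$ with values of
the increasing convex kernel at the grid points.

The functional analysis is done on a finite-dimensional space $V$: `J` stands for the embedding into
$L^2$, `D` for the gradient and `e` for the constant function $1$. -/

namespace NonlocalDiffusion

/-! ### The kernel `(s - η) ^ (-α)` -/

section Kernel

variable {s α p q : ℝ}

lemma hasDerivAt_kernel {x : ℝ} (hx : x < s) :
    HasDerivAt (fun η => (s - η) ^ (-α)) (α * (s - x) ^ (-α - 1)) x := by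
  have h := ((hasDerivAt_id x).const_sub s).rpow_const (p := -α) (Or.inl (sub_pos.2 hx).ne')
  exact h.congr_deriv (show -1 * -α * (s - x) ^ (-α - 1) = _ by ring)

lemma kernel_continuousOn (hq : q < s) :
    ContinuousOn (fun η => (s - η) ^ (-α)) (Set.Icc p q) := fun _ hx =>
  (hasDerivAt_kernel (hx.2.trans_lt hq)).continuousAt.continuousWithinAt

lemma kernel_mono (hα : 0 < α) {x y : ℝ} (hxy : x ≤ y) (hy : y < s) :
    (s - x) ^ (-α) ≤ (s - y) ^ (-α) :=
  Real.rpow_le_rpow_of_nonpos (sub_pos.2 hy) (by linarith) (by linarith)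

/-- Convexity: the slope is increasing, so the slope at any `c` to the right of the interval
dominates. `le_kernel_sub` is the counterpart with `c` on the left. -/
lemma kernel_sub_le (hα : 0 < α) {x y c : ℝ} (hxy : x ≤ y) (hyc : y ≤ c) (hc : c < s) :
    (s - y) ^ (-α) - (s - x) ^ (-α) ≤ α * (s - c) ^ (-α - 1) * (y - x) := by
  refine (convex_Icc x y).image_sub_le_mul_sub_of_deriv_le (f := fun η => (s - η) ^ (-α))
    (kernel_continuousOn (by linarith)) (fun z hz => ?_) (fun z hz => ?_)
    x (Set.left_mem_Icc.2 hxy) y (Set.right_mem_Icc.2 hxy) hxy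
  · rw [interior_Icc] at hz
    exact (hasDerivAt_kernel (by linarith [hz.2])).differentiableAt.differentiableWithinAt
  · rw [interior_Icc] at hz
    rw [(hasDerivAt_kernel (α := α) (show z < s by linarith [hz.2])).deriv]
    exact mul_le_mul_of_nonneg_left
      (Real.rpow_le_rpow_of_nonpos (sub_pos.2 hc) (by linarith [hz.2]) (by linarith)) hα.le

lemma le_kernel_sub (hα : 0 < α) {x y c : ℝ} (hxy : x ≤ y) (hcx : c ≤ x) (hy : y < s) :
    α * (s - c) ^ (-α - 1) * (y - x) ≤ (s - y) ^ (-α) - (s - x) ^ (-α) := by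
  refine (convex_Icc x y).mul_sub_le_image_sub_of_le_deriv (f := fun η => (s - η) ^ (-α))
    (kernel_continuousOn (by linarith)) (fun z hz => ?_) (fun z hz => ?_)
    x (Set.left_mem_Icc.2 hxy) y (Set.right_mem_Icc.2 hxy) hxy
  · rw [interior_Icc] at hz
    exact (hasDerivAt_kernel (by linarith [hz.2])).differentiableAt.differentiableWithinAt
  · rw [interior_Icc] at hz
    rw [(hasDerivAt_kernel (α := α) (show z < s by linarith [hz.2])).deriv]
    exact mul_le_mul_of_nonneg_left
      (Real.rpow_le_rpow_of_nonpos (by linarith [hz.2]) (by linarith [hz.1]) (by linarith)) hα.le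

lemma kernel_intervalIntegrable (hpq : p ≤ q) (hq : q < s) :
    IntervalIntegrable (fun η => (s - η) ^ (-α)) volume p q :=
  ContinuousOn.intervalIntegrable (by rw [Set.uIcc_of_le hpq]; exact kernel_continuousOn hq)

lemma kernel_moment_intervalIntegrable (hpq : p ≤ q) (hq : q < s) (m : ℝ) :
    IntervalIntegrable (fun η => (s - η) ^ (-α) * (η - m)) volume p q :=
  (kernel_intervalIntegrable hpq hq).mul_continuousOn (by fun_prop)

lemma integral_sub_midpoint (c : ℝ) : ∫ η in p..q, c * (η - (p + q) / 2) = 0 := by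
  rw [intervalIntegral.integral_const_mul, intervalIntegral.integral_sub (by simp) (by simp),
    integral_id, intervalIntegral.integral_const, smul_eq_mul]
  ring

lemma integral_sub_midpoint_sq : ∫ η in p..q, (η - (p + q) / 2) ^ 2 = (q - p) ^ 3 / 12 := by
  rw [intervalIntegral.integral_comp_sub_right (fun x => x ^ 2), integral_pow]
  push_cast
  ring

/-- The weight is odd about the midpoint, so the kernel may be replaced by its increment from the
midpoint, which has the sign of the weight. -/
lemma kernel_moment_nonneg (hα : 0 < α) (hpq : p ≤ q) (hq : q < s) :
    0 ≤ ∫ η in p..q, (s - η) ^ (-α) * (η - (p + q) / 2) := by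
  rw [← integral_sub_midpoint (p := p) (q := q) ((s - (p + q) / 2) ^ (-α))]
  refine intervalIntegral.integral_mono_on hpq ((by fun_prop : Continuous _).intervalIntegrable _ _)
    (kernel_moment_intervalIntegrable hpq hq _) fun x hx => ?_
  rcases le_total x ((p + q) / 2) with h | h
  · exact mul_le_mul_of_nonpos_right (kernel_mono hα h (by linarith)) (by linarith)
  · exact mul_le_mul_of_nonneg_right (kernel_mono hα h (by linarith [hx.2])) (by linarith)

lemma kernel_moment_le (hα : 0 < α) (hpq : p ≤ q) (hq : q < s) :
    ∫ η in p..q, (s - η) ^ (-α) * (η - (p + q) / 2)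
      ≤ α * (s - q) ^ (-α - 1) * ((q - p) ^ 3 / 12) := by
  have h0 : ∫ η in p..q, (α * (s - q) ^ (-α - 1) * (η - (p + q) / 2) ^ 2 +
      (s - (p + q) / 2) ^ (-α) * (η - (p + q) / 2)) =
      α * (s - q) ^ (-α - 1) * ((q - p) ^ 3 / 12) := by
    rw [intervalIntegral.integral_add ((by fun_prop : Continuous _).intervalIntegrable _ _)
      ((by fun_prop : Continuous _).intervalIntegrable _ _), integral_sub_midpoint,
      intervalIntegral.integral_const_mul, integral_sub_midpoint_sq, add_zero]
  rw [← h0]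
  refine intervalIntegral.integral_mono_on hpq (kernel_moment_intervalIntegrable hpq hq _)
    ((by fun_prop : Continuous _).intervalIntegrable _ _) fun x hx => ?_
  -- On either side of the midpoint the kernel differs from its midpoint value by at most the slope
  -- at `q` times the distance.
  rcases le_total x ((p + q) / 2) with h | h
  · have := kernel_sub_le hα h (by linarith : (p + q) / 2 ≤ q) hq
    nlinarith [mul_le_mul_of_nonneg_right this (sub_nonneg.2 h)]
  · have := kernel_sub_le hα h hx.2 hq
    nlinarith [mul_le_mul_of_nonneg_right this (sub_nonneg.2 h)]

/-- The subtracted quadratic term, a gain from the slope of the kernel, later pays for $b_{n,j-1}$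
in `aCoeff_add_bCoeff_le`. -/
lemma integral_kernel_le (hα : 0 < α) (hpq : p ≤ q) (hq : q < s) :
    ∫ η in p..q, (s - η) ^ (-α)
      ≤ (q - p) * (s - q) ^ (-α) - α * (s - p) ^ (-α - 1) * ((q - p) ^ 2 / 2) := by
  have h0 : ∫ η in p..q, ((s - q) ^ (-α) - α * (s - p) ^ (-α - 1) * (q - η)) =
      (q - p) * (s - q) ^ (-α) - α * (s - p) ^ (-α - 1) * ((q - p) ^ 2 / 2) := by
    rw [intervalIntegral.integral_sub ((by fun_prop : Continuous _).intervalIntegrable _ _)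
      ((by fun_prop : Continuous _).intervalIntegrable _ _),
      intervalIntegral.integral_const_mul, intervalIntegral.integral_const,
      intervalIntegral.integral_sub (by simp) (by simp), integral_id,
      intervalIntegral.integral_const, smul_eq_mul, smul_eq_mul]
    ring
  rw [← h0]
  refine intervalIntegral.integral_mono_on hpq (kernel_intervalIntegrable hpq hq)
    ((by fun_prop : Continuous _).intervalIntegrable _ _) fun x hx => ?_
  linarith [le_kernel_sub hα hx.2 hx.1 hq]

/-- The two integrals combine into the kernel times $1-\frac2w(\eta-\frac{p+q}2)$. This weight is
nonnegative since $w\ge q-p$, and has integral $q-p$, so the kernel may be replaced by its minimum,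
at `p`. -/
lemma le_integral_kernel_sub_moment (hα : 0 < α) (hpq : p < q) (hq : q < s) {w : ℝ}
    (hw : q - p ≤ w) :
    (q - p) * (s - p) ^ (-α) ≤ (∫ η in p..q, (s - η) ^ (-α)) -
      2 / w * ∫ η in p..q, (s - η) ^ (-α) * (η - (p + q) / 2) := by
  have hw0 : 0 < w := by linarith
  have h0 : ∫ η in p..q, ((s - p) ^ (-α) - 2 / w * (s - p) ^ (-α) * (η - (p + q) / 2)) =
      (q - p) * (s - p) ^ (-α) := by
    rw [intervalIntegral.integral_sub ((by fun_prop : Continuous _).intervalIntegrable _ _)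
      ((by fun_prop : Continuous _).intervalIntegrable _ _), integral_sub_midpoint,
      intervalIntegral.integral_const, smul_eq_mul, sub_zero]
  rw [← h0, ← intervalIntegral.integral_const_mul, ← intervalIntegral.integral_sub
    (kernel_intervalIntegrable hpq.le hq)
    ((kernel_moment_intervalIntegrable hpq.le hq _).const_mul _)]
  refine intervalIntegral.integral_mono_on hpq.le
    ((by fun_prop : Continuous _).intervalIntegrable _ _)
    ((kernel_intervalIntegrable hpq.le hq).sub
      ((kernel_moment_intervalIntegrable hpq.le hq _).const_mul _)) fun x hx => ?_
  have h1 := kernel_mono hα hx.1 (hx.2.trans_lt hq)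
  have h2 : 0 ≤ 1 - 2 / w * (x - (p + q) / 2) := by
    rw [sub_nonneg, div_mul_eq_mul_div, div_le_one hw0]
    linarith [hx.2]
  nlinarith [mul_nonneg (sub_nonneg.2 h1) h2]

lemma integral_kernel_endpoint (hα : α < 1) (hp : p < s) :
    (1 - α) * ∫ η in p..s, (s - η) ^ (-α) = (s - p) * (s - p) ^ (-α) := by
  rw [intervalIntegral.integral_comp_sub_left (fun x => x ^ (-α)), sub_self,
    integral_rpow (Or.inl (by linarith)), Real.zero_rpow (by linarith),
    show -α + 1 = 1 + -α by ring, Real.rpow_add (sub_pos.2 hp), Real.rpow_one]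
  have : 1 + -α ≠ 0 := by linarith
  field_simp
  ring

end Kernel

/-! ### The graded mesh -/

section Grid

variable {T r α : ℝ} {N n j : ℕ}

lemma gridTime_lt_succ (hT : 0 < T) (hr : 1 ≤ r) (hN : 0 < N) (j : ℕ) :
    gridTime T r N j < gridTime T r N (j + 1) := by
  unfold gridTime
  have hN' : (0 : ℝ) < N := by exact_mod_cast hN
  refine mul_lt_mul_of_pos_left (Real.rpow_lt_rpow (by positivity) ?_ (by linarith)) hT
  exact div_lt_div_of_pos_right (by push_cast; linarith) hN'

lemma gridTime_mono (hT : 0 < T) (hr : 1 ≤ r) (hN : 0 < N) : Monotone (gridTime T r N) :=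
  monotone_nat_of_le_succ fun j => (gridTime_lt_succ hT hr hN j).le

lemma gridTime_zero (hr : 1 ≤ r) : gridTime T r N 0 = 0 := by
  simp [gridTime, Real.zero_rpow (by linarith : r ≠ 0)]

lemma gridTime_last (hN : 0 < N) : gridTime T r N N = T := by
  have : (N : ℝ) ≠ 0 := by exact_mod_cast hN.ne'
  simp [gridTime, div_self this]

/-- Midpoint convexity of $x\mapsto x^r$ for $r\ge1$. -/
lemma gridTime_step_mono (hT : 0 < T) (hr : 1 ≤ r) (j : ℕ) :
    gridTime T r N (j + 1) - gridTime T r N j ≤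
      gridTime T r N (j + 2) - gridTime T r N (j + 1) := by
  unfold gridTime
  have h := (convexOn_rpow hr).2 (x := (j : ℝ) / N) (y := ((j + 2 : ℕ) : ℝ) / N)
    (Set.mem_Ici.2 (by positivity)) (Set.mem_Ici.2 (by positivity))
    (by norm_num : (0 : ℝ) ≤ 1 / 2) (by norm_num : (0 : ℝ) ≤ 1 / 2) (by norm_num)
  simp only [smul_eq_mul] at h
  rw [show (1 / 2 : ℝ) * ((j : ℝ) / N) + 1 / 2 * (((j + 2 : ℕ) : ℝ) / N)
    = ((j + 1 : ℕ) : ℝ) / N by push_cast; ring] at h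
  nlinarith

lemma timeStep_pos (hT : 0 < T) (hr : 1 ≤ r) (hN : 0 < N) (hj : 1 ≤ j) :
    0 < timeStep T r N j := by
  obtain ⟨j, rfl⟩ := Nat.exists_eq_add_of_le' hj
  exact sub_pos.2 (gridTime_lt_succ hT hr hN j)

end Grid

/-! ### Comparison of the coefficients $g_{n,j}$ with the kernel at the grid points. -/

section Coefficients

variable {T r α : ℝ} {N n j : ℕ}

/-- The value at `t_j` of the kernel of the fractional derivative at `t_{n-σ}`. -/
noncomputable def kernelAt (T r α : ℝ) (N n j : ℕ) : ℝ :=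
  1 / Real.Gamma (1 - α) * (offsetTime T r α N n - gridTime T r N j) ^ (-α)

lemma gridTime_lt_offsetTime (hT : 0 < T) (hr : 1 ≤ r) (hα1 : α < 1) (hN : 0 < N)
    (hj : j < n) : gridTime T r N j < offsetTime T r α N n := by
  have h1 : gridTime T r N j ≤ gridTime T r N (n - 1) := gridTime_mono hT hr hN (by omega)
  have h2 := timeStep_pos hT hr hN (show 1 ≤ n by omega)
  unfold timeStep at h2
  unfold offsetTime
  nlinarith

lemma bCoeff_nonneg (hT : 0 < T) (hr : 1 ≤ r) (hα0 : 0 < α) (hα1 : α < 1) (hN : 0 < N)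
    (hj : j < n) : 0 ≤ bCoeff T r α N n j := by
  unfold bCoeff
  split_ifs with h
  · rfl
  have hΓ : 0 < Real.Gamma (1 - α) := Real.Gamma_pos_of_pos (by linarith)
  have hm := gridTime_mono hT hr hN
  refine mul_nonneg (div_nonneg zero_le_two (mul_nonneg hΓ.le (sub_nonneg.2 (hm (by omega)))))
    (kernel_moment_nonneg hα0 (hm (by omega)) (gridTime_lt_offsetTime hT hr hα1 hN hj))

lemma aCoeff_of_lt (hj : j < n) : aCoeff T r α N n j = 1 / Real.Gamma (1 - α) *
    ∫ η in (gridTime T r N (j - 1))..(gridTime T r N j), (offsetTime T r α N n - η) ^ (-α) := by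
  rw [aCoeff, if_neg hj.ne]

lemma bCoeff_of_pos (hj : j ≠ 0) : bCoeff T r α N n j = 1 / Real.Gamma (1 - α) *
    (2 / (gridTime T r N (j + 1) - gridTime T r N (j - 1)) *
      ∫ η in (gridTime T r N (j - 1))..(gridTime T r N j), (offsetTime T r α N n - η) ^ (-α) *
          (η - (gridTime T r N (j - 1) + gridTime T r N j) / 2)) := by
  rw [bCoeff, if_neg hj, ← mul_assoc, div_mul_div_comm, one_mul]

lemma timeStep_mul_kernelAt_le (hT : 0 < T) (hr : 1 ≤ r) (hα0 : 0 < α) (hα1 : α < 1)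
    (hN : 0 < N) (hj0 : 1 ≤ j) (hj : j < n) :
    timeStep T r N j * kernelAt T r α N n (j - 1) ≤
      aCoeff T r α N n j - bCoeff T r α N n j := by
  have hΓ : 0 < Real.Gamma (1 - α) := Real.Gamma_pos_of_pos (by linarith)
  rw [aCoeff_of_lt hj, bCoeff_of_pos (by omega), ← mul_sub, kernelAt, mul_left_comm]
  refine mul_le_mul_of_nonneg_left ?_ (by positivity)
  refine le_integral_kernel_sub_moment hα0 (sub_pos.1 (timeStep_pos hT hr hN hj0))
    (gridTime_lt_offsetTime hT hr hα1 hN hj) ?_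
  linarith [gridTime_lt_succ hT hr hN j]

/-- The moment $b_{n,j-1}$ lives on the preceding interval. Both it and the gain in
`integral_kernel_le` are measured by the kernel slope at the common node $t_{j-1}$, and the gain
wins because the steps do not decrease. -/
lemma aCoeff_add_bCoeff_le (hT : 0 < T) (hr : 1 ≤ r) (hα0 : 0 < α) (hα1 : α < 1)
    (hN : 0 < N) (hj0 : 1 ≤ j) (hj : j < n) :
    aCoeff T r α N n j + bCoeff T r α N n (j - 1) ≤
      timeStep T r N j * kernelAt T r α N n j := by
  have hΓ : 0 < Real.Gamma (1 - α) := Real.Gamma_pos_of_pos (by linarith)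
  have hs := gridTime_lt_offsetTime (α := α) hT hr hα1 hN hj
  obtain ⟨j, rfl⟩ := Nat.exists_eq_add_of_le' hj0
  rw [Nat.add_sub_cancel]
  have hlt := gridTime_lt_succ hT hr hN j
  have ha := integral_kernel_le hα0 hlt.le hs
  set s := offsetTime T r α N n
  set D := α * (s - gridTime T r N j) ^ (-α - 1) with hD
  have hD0 : 0 ≤ D := mul_nonneg hα0.le (Real.rpow_nonneg (by linarith) _)
  have hb : bCoeff T r α N n j ≤ 1 / Real.Gamma (1 - α) *
      (D * ((gridTime T r N (j + 1) - gridTime T r N j) ^ 2 / 2)) := by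
    rcases Nat.eq_zero_or_pos j with rfl | hjp
    · rw [bCoeff, if_pos rfl]
      positivity
    rw [bCoeff_of_pos hjp.ne']
    refine mul_le_mul_of_nonneg_left ?_ (by positivity)
    have hlt' := sub_pos.1 (timeStep_pos hT hr hN hjp)
    have hstep := gridTime_step_mono (N := N) hT hr (j - 1)
    rw [show j - 1 + 1 = j by omega, show j - 1 + 2 = j + 1 by omega] at hstep
    have hm := kernel_moment_le hα0 hlt'.le (hlt.trans hs)
    rw [← hD] at hm
    set x := gridTime T r N j - gridTime T r N (j - 1) with hx
    set y := gridTime T r N (j + 1) - gridTime T r N j with hy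
    have hx0 : 0 < x := sub_pos.2 hlt'
    have hw : gridTime T r N (j + 1) - gridTime T r N (j - 1) = x + y := by rw [hx, hy]; ring
    rw [hw, div_mul_eq_mul_div, div_le_iff₀ (by linarith)]
    -- The factor $1/6$ is the $1/12$ of the second moment times the $2$ in $b_{n,j}$.
    have h3 : x ^ 3 / 6 ≤ y ^ 2 / 2 * (x + y) := by
      have h1 : x ^ 3 ≤ y ^ 3 := pow_le_pow_left₀ hx0.le hstep 3
      nlinarith [mul_nonneg (sq_nonneg y) hx0.le, pow_pos hx0 3]
    nlinarith [mul_le_mul_of_nonneg_left h3 hD0]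
  rw [aCoeff_of_lt hj, Nat.add_sub_cancel, kernelAt, timeStep, Nat.add_sub_cancel]
  calc _ ≤ 1 / Real.Gamma (1 - α) * ((gridTime T r N (j + 1) - gridTime T r N j) *
        (s - gridTime T r N (j + 1)) ^ (-α) - D * ((gridTime T r N (j + 1)
          - gridTime T r N j) ^ 2 / 2)) + 1 / Real.Gamma (1 - α) *
      (D * ((gridTime T r N (j + 1) - gridTime T r N j) ^ 2 / 2)) :=
        add_le_add (mul_le_mul_of_nonneg_left ha (by positivity)) hb
    _ = _ := by ring

/-- The last interval ends at the singularity and has length $(1-\sigma)\tau_n$, so its integral is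
explicit. -/
lemma aCoeff_self (hT : 0 < T) (hr : 1 ≤ r) (hα1 : α < 1) (hN : 0 < N) (hn : 1 ≤ n) :
    (1 - α) * aCoeff T r α N n n =
      (1 - α / 2) * (timeStep T r N n * kernelAt T r α N n (n - 1)) := by
  have hs := gridTime_lt_offsetTime (α := α) hT hr hα1 hN (show n - 1 < n by omega)
  have hd : offsetTime T r α N n - gridTime T r N (n - 1) = (1 - α / 2) * timeStep T r N n := by
    rw [offsetTime, timeStep]; ring
  have h := integral_kernel_endpoint hα1 hs
  rw [aCoeff, if_pos rfl, mul_left_comm, h, kernelAt, hd]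
  ring

lemma kernelAt_nonneg (hT : 0 < T) (hr : 1 ≤ r) (hα1 : α < 1) (hN : 0 < N) (hj : j < n) :
    0 ≤ kernelAt T r α N n j :=
  mul_nonneg (one_div_nonneg.2 (Real.Gamma_pos_of_pos (by linarith)).le)
    (Real.rpow_nonneg (sub_nonneg.2 (gridTime_lt_offsetTime hT hr hα1 hN hj).le) _)

/-- The convention $b_{n,0}=0$ absorbs the separate case $j=1$. -/
lemma gCoeff_of_lt (hj0 : 1 ≤ j) (hj : j < n) : gCoeff T r α N n j = (timeStep T r N j)⁻¹ *
    (aCoeff T r α N n j + bCoeff T r α N n (j - 1) - bCoeff T r α N n j) := by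
  rw [gCoeff, if_neg (by omega)]
  split_ifs with h
  · subst h; simp [bCoeff]
  · rfl

lemma gCoeff_self (hn : 1 ≤ n) : gCoeff T r α N n n = (timeStep T r N n)⁻¹ *
    (aCoeff T r α N n n + bCoeff T r α N n (n - 1)) := by
  rw [gCoeff]
  split_ifs with h h'
  · subst h; simp [bCoeff]
  · omega
  · rfl

lemma gCoeff_le_kernelAt (hT : 0 < T) (hr : 1 ≤ r) (hα0 : 0 < α) (hα1 : α < 1)
    (hN : 0 < N) (hj0 : 1 ≤ j) (hj : j < n) :
    gCoeff T r α N n j ≤ kernelAt T r α N n j := by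
  rw [gCoeff_of_lt hj0 hj, inv_mul_le_iff₀ (timeStep_pos hT hr hN hj0)]
  linarith [aCoeff_add_bCoeff_le hT hr hα0 hα1 hN hj0 hj, bCoeff_nonneg hT hr hα0 hα1 hN hj]

lemma kernelAt_le_gCoeff (hT : 0 < T) (hr : 1 ≤ r) (hα0 : 0 < α) (hα1 : α < 1)
    (hN : 0 < N) (hj0 : 1 ≤ j) (hj : j < n) :
    kernelAt T r α N n (j - 1) ≤ gCoeff T r α N n j := by
  rw [gCoeff_of_lt hj0 hj, le_inv_mul_iff₀ (timeStep_pos hT hr hN hj0)]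
  linarith [timeStep_mul_kernelAt_le hT hr hα0 hα1 hN hj0 hj,
    bCoeff_nonneg hT hr hα0 hα1 hN (show j - 1 < n by omega)]

lemma kernelAt_le_gCoeff_self (hT : 0 < T) (hr : 1 ≤ r) (hα0 : 0 < α) (hα1 : α < 1)
    (hN : 0 < N) (hn : 1 ≤ n) :
    (1 - α / 2) * kernelAt T r α N n (n - 1) ≤ (1 - α) * gCoeff T r α N n n := by
  have hτ := timeStep_pos hT hr hN hn
  rw [gCoeff_self hn, mul_left_comm, le_inv_mul_iff₀ hτ, mul_add, aCoeff_self hT hr hα1 hN hn]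
  have := mul_nonneg (sub_nonneg.2 hα1.le)
    (bCoeff_nonneg hT hr hα0 hα1 hN (show n - 1 < n by omega))
  linarith

/-- The kernel value at $t_j$ separates $g_{n,j}$ from $g_{n,j+1}$. -/
lemma gCoeff_mono (hT : 0 < T) (hr : 1 ≤ r) (hα0 : 0 < α) (hα1 : α < 1)
    (hN : 0 < N) (hj0 : 1 ≤ j) (hj : j < n) :
    gCoeff T r α N n j ≤ gCoeff T r α N n (j + 1) := by
  have h1 := gCoeff_le_kernelAt hT hr hα0 hα1 hN hj0 hj
  rcases (show j + 1 < n ∨ n = j + 1 by omega) with h | rfl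
  · have h2 := kernelAt_le_gCoeff hT hr hα0 hα1 hN (show 1 ≤ j + 1 by omega) h
    rw [Nat.add_sub_cancel] at h2
    exact h1.trans h2
  · have h2 := kernelAt_le_gCoeff_self hT hr hα0 hα1 hN (show 1 ≤ j + 1 by omega)
    rw [Nat.add_sub_cancel] at h2
    have h3 := kernelAt_nonneg hT hr hα1 hN hj
    have h4 : (1 - α) * kernelAt T r α N (j + 1) j ≤ (1 - α / 2) * kernelAt T r α N (j + 1) j :=
      mul_le_mul_of_nonneg_right (by linarith) h3
    exact h1.trans (le_of_mul_le_mul_left (h4.trans h2) (sub_pos.2 hα1))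

lemma gCoeff_pred_le (hT : 0 < T) (hr : 1 ≤ r) (hα0 : 0 < α) (hα1 : α < 1)
    (hN : 0 < N) (hn : 2 ≤ n) :
    (1 - α / 2) ^ 2 * gCoeff T r α N n (n - 1) ≤ (1 - α) * gCoeff T r α N n n := by
  have h1 := gCoeff_le_kernelAt hT hr hα0 hα1 hN (show 1 ≤ n - 1 by omega)
    (show n - 1 < n by omega)
  have h2 := kernelAt_le_gCoeff_self hT hr hα0 hα1 hN (show 1 ≤ n by omega)
  have h3 := kernelAt_nonneg hT hr hα1 hN (show n - 1 < n by omega)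
  have h4 : (1 - α / 2) ^ 2 * kernelAt T r α N n (n - 1) ≤
      (1 - α / 2) * kernelAt T r α N n (n - 1) :=
    mul_le_mul_of_nonneg_right (by nlinarith) h3
  exact (mul_le_mul_of_nonneg_left h1 (sq_nonneg _)).trans (h4.trans h2)

/-- Since $t_{n-\sigma}\le T$, the kernel at time $0$ has a lower bound independent of $n$ and $N$.
This makes the stability constant uniform. -/
lemma rpow_le_gCoeff_one (hT : 0 < T) (hr : 1 ≤ r) (hα0 : 0 < α) (hα1 : α < 1)
    (hn : 1 ≤ n) (hnN : n ≤ N) :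
    1 / Real.Gamma (1 - α) * T ^ (-α) ≤ gCoeff T r α N n 1 := by
  have hN : 0 < N := by omega
  have hΓ : 0 < Real.Gamma (1 - α) := Real.Gamma_pos_of_pos (by linarith)
  have hk : 1 / Real.Gamma (1 - α) * T ^ (-α) ≤ kernelAt T r α N n 0 := by
    have hlt := gridTime_lt_offsetTime (α := α) hT hr hα1 hN (show 0 < n by omega)
    rw [gridTime_zero hr] at hlt
    rw [kernelAt, gridTime_zero hr, sub_zero]
    refine mul_le_mul_of_nonneg_left
      (Real.rpow_le_rpow_of_nonpos hlt ?_ (by linarith)) (by positivity)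
    have h1 : gridTime T r N n ≤ T := by
      exact (gridTime_mono hT hr hN hnN).trans_eq (gridTime_last hN)
    have h2 : gridTime T r N (n - 1) ≤ gridTime T r N n := gridTime_mono hT hr hN (by omega)
    unfold offsetTime
    nlinarith
  refine hk.trans ?_
  rcases (show 1 < n ∨ n = 1 by omega) with h | rfl
  · have h2 := kernelAt_le_gCoeff hT hr hα0 hα1 hN le_rfl h
    rwa [Nat.sub_self] at h2
  · have h2 := kernelAt_le_gCoeff_self hT hr hα0 hα1 hN le_rfl
    have h3 := kernelAt_nonneg hT hr hα1 hN (show 0 < 1 by omega)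
    rw [Nat.sub_self] at h2
    have h4 : (1 - α) * kernelAt T r α N 1 0 ≤ (1 - α / 2) * kernelAt T r α N 1 0 :=
      mul_le_mul_of_nonneg_right (by linarith) h3
    exact le_of_mul_le_mul_left (h4.trans h2) (sub_pos.2 hα1)

end Coefficients

/-! ### The scheme on an abstract finite-dimensional space -/

section Abel

lemma sum_Icc_mul_sub (g z : ℕ → ℝ) (n : ℕ) :
    ∑ j ∈ Finset.Icc 1 (n + 1), g j * (z j - z (j - 1)) =
      g (n + 1) * z (n + 1) - g 1 * z 0 - ∑ j ∈ Finset.Icc 1 n, (g (j + 1) - g j) * z j := by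
  induction n with
  | zero => simp; ring
  | succ n ih =>
    rw [Finset.sum_Icc_succ_top (by omega), ih,
      Finset.sum_Icc_succ_top (show 1 ≤ n + 1 by omega), Nat.add_sub_cancel]
    ring

/-- Discrete maximum principle. After summation by parts, $g_{n+1}y_{n+1}$ is at most $Q+g_1y_0$
plus a combination of earlier values with nonnegative weights of sum $g_{n+1}-g_1$. The condition on
`M` lets $g_1M$ absorb $Q+g_1y_0$. -/
lemma le_of_sum_mul_sub_le {g y : ℕ → ℝ} {n : ℕ} {c Q M : ℝ} (hc : 0 < c) (hcg : c ≤ g 1)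
    (hmono : ∀ j, 1 ≤ j → j < n + 1 → g j ≤ g (j + 1))
    (hy : ∑ j ∈ Finset.Icc 1 (n + 1), g j * (y j - y (j - 1)) ≤ Q) (hQ : 0 ≤ Q)
    (hM : ∀ j, 1 ≤ j → j < n + 1 → y j ≤ M) (hM0 : y 0 + Q / c ≤ M) : y (n + 1) ≤ M := by
  have hgn : c ≤ g (n + 1) := by
    have h : ∀ m, 1 ≤ m → m ≤ n + 1 → c ≤ g m := by
      intro m hm
      induction m, hm using Nat.le_induction with
      | base => exact fun _ => hcg
      | succ m hm ih => exact fun h => (ih (by omega)).trans (hmono m hm (by omega))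
    exact h _ (by omega) le_rfl
  rw [sum_Icc_mul_sub] at hy
  have h1 : ∑ j ∈ Finset.Icc 1 n, (g (j + 1) - g j) * y j ≤
      ∑ j ∈ Finset.Icc 1 n, (g (j + 1) - g j) * M := by
    refine Finset.sum_le_sum fun j hj => ?_
    rw [Finset.mem_Icc] at hj
    exact mul_le_mul_of_nonneg_left (hM j hj.1 (by omega))
      (sub_nonneg.2 (hmono j hj.1 (by omega)))
  have h2 : ∑ j ∈ Finset.Icc 1 n, (g (j + 1) - g j) * M = (g (n + 1) - g 1) * M := by
    have := sum_Icc_mul_sub g (fun _ => M) n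
    simp only [sub_self, mul_zero, Finset.sum_const_zero] at this
    linarith
  have h3 : Q ≤ g 1 * (M - y 0) := by
    have : Q / c ≤ M - y 0 := by linarith
    rw [div_le_iff₀ hc] at this
    nlinarith [mul_nonneg (sub_nonneg.2 hcg) ((div_nonneg hQ hc.le).trans
      (show Q / c ≤ M - y 0 by linarith))]
  have h4 : g (n + 1) * y (n + 1) ≤ g (n + 1) * M := by nlinarith
  exact le_of_mul_le_mul_left h4 (hc.trans_le hgn)

end Abel

variable {V H₁ H₂ : Type*} [AddCommGroup V] [Module ℝ V]
  [NormedAddCommGroup H₁] [InnerProductSpace ℝ H₁]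
  [NormedAddCommGroup H₂] [InnerProductSpace ℝ H₂]

/-- Alikhanov's inequality
`½ ∑ g_j (‖u_j‖² - ‖u_{j-1}‖²) ≤ (∑ g_j (u_j - u_{j-1}), (1 - σ) u_n + σ u_{n-1})`. -/
lemma half_sum_le_inner {g : ℕ → ℝ} {σ : ℝ} {n : ℕ} (u : ℕ → H₂) (hn : 1 ≤ n)
    (hσ : σ ≤ 1 / 2) (hg1 : 0 ≤ g 1) (hmono : ∀ j, 1 ≤ j → j < n → g j ≤ g (j + 1))
    (hlast : 2 ≤ n → (1 - σ) ^ 2 * g (n - 1) ≤ (1 - 2 * σ) * g n) :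
    (1 / 2) * ∑ j ∈ Finset.Icc 1 n, g j * (‖u j‖ ^ 2 - ‖u (j - 1)‖ ^ 2) ≤
      inner ℝ (∑ j ∈ Finset.Icc 1 n, g j • (u j - u (j - 1)))
        ((1 - σ) • u n + σ • u (n - 1)) := by
  set w := (1 - σ) • u n + σ • u (n - 1) with hw
  -- Polarization about `w`: the first part is the desired sum, and the second is shown to have a
  -- nonpositive sum by summation by parts.
  have key : ∀ j, g j * inner ℝ (u j - u (j - 1)) w =
      (1 / 2) * (g j * (‖u j‖ ^ 2 - ‖u (j - 1)‖ ^ 2)) -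
        (1 / 2) * (g j * (‖w - u j‖ ^ 2 - ‖w - u (j - 1)‖ ^ 2)) := by
    intro j
    rw [norm_sub_sq_real, norm_sub_sq_real, inner_sub_left, real_inner_comm w, real_inner_comm w]
    ring
  rw [sum_inner]
  simp only [real_inner_smul_left]
  rw [Finset.sum_congr rfl fun j _ => key j, Finset.sum_sub_distrib, ← Finset.mul_sum,
    ← Finset.mul_sum]
  obtain ⟨m, rfl⟩ := Nat.exists_eq_add_of_le' hn
  have hAbel := sum_Icc_mul_sub g (fun j => ‖w - u j‖ ^ 2) m
  rw [Nat.add_sub_cancel] at hw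
  have hz1 : ‖w - u (m + 1)‖ ^ 2 = σ ^ 2 * ‖u (m + 1) - u m‖ ^ 2 := by
    have : w - u (m + 1) = (-σ) • (u (m + 1) - u m) := by rw [hw]; module
    rw [this, norm_smul, mul_pow, Real.norm_eq_abs, sq_abs, neg_sq]
  have hz0 : ‖w - u m‖ ^ 2 = (1 - σ) ^ 2 * ‖u (m + 1) - u m‖ ^ 2 := by
    have : w - u m = (1 - σ) • (u (m + 1) - u m) := by rw [hw]; module
    rw [this, norm_smul, mul_pow, Real.norm_eq_abs, sq_abs]
  suffices h : g (m + 1) * ‖w - u (m + 1)‖ ^ 2 ≤ g 1 * ‖w - u 0‖ ^ 2 +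
      ∑ j ∈ Finset.Icc 1 m, (g (j + 1) - g j) * ‖w - u j‖ ^ 2 by linarith
  rcases Nat.eq_zero_or_pos m with rfl | hm
  · simp only [Finset.Icc_eq_empty (show ¬ (1 ≤ 0) by omega), Finset.sum_empty, add_zero]
    rw [zero_add] at hz1 hz0 ⊢
    rw [hz0, hz1]
    exact mul_le_mul_of_nonneg_left
      (mul_le_mul_of_nonneg_right (by nlinarith) (sq_nonneg _)) hg1
  -- Only the last term of the sum is needed. Since $(1-\sigma)^2-\sigma^2=1-2\sigma$, `hlast` is
  -- exactly what makes it dominate.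
  · have h1 : (g (m + 1) - g m) * ‖w - u m‖ ^ 2 ≤
        ∑ j ∈ Finset.Icc 1 m, (g (j + 1) - g j) * ‖w - u j‖ ^ 2 := by
      refine Finset.single_le_sum (f := fun j => (g (j + 1) - g j) * ‖w - u j‖ ^ 2)
        (fun j hj => ?_) (Finset.mem_Icc.2 ⟨hm, le_rfl⟩)
      rw [Finset.mem_Icc] at hj
      exact mul_nonneg (sub_nonneg.2 (hmono j hj.1 (by omega))) (sq_nonneg _)
    have h2 : g (m + 1) * σ ^ 2 ≤ (g (m + 1) - g m) * (1 - σ) ^ 2 := by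
      have := hlast (by omega)
      rw [Nat.add_sub_cancel] at this
      nlinarith
    have h3 := mul_le_mul_of_nonneg_right h2 (sq_nonneg ‖u (m + 1) - u m‖)
    have h4 := mul_nonneg hg1 (sq_nonneg ‖w - u 0‖)
    rw [hz0] at h1
    rw [hz1]
    linarith

/-- The equation of the scheme at level `n`. -/
def LevelEq (J : V →ₗ[ℝ] H₁) (D : V →ₗ[ℝ] H₂) (e : H₁) (a : ℝ → ℝ) (σ : ℝ) (g : ℕ → ℝ) (φ : H₁)
    (U : ℕ → V) (n : ℕ) : Prop :=
  ∀ v, inner ℝ (J (∑ j ∈ Finset.Icc 1 n, g j • (U j - U (j - 1)))) (J v) +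
    a (inner ℝ e (J ((1 - σ) • U n + σ • U (n - 1)))) *
      inner ℝ (D ((1 - σ) • U n + σ • U (n - 1))) (D v) = inner ℝ φ (J v)

/-! ### Linear problems and the a priori gradient bound. -/

section Linear

variable [FiniteDimensional ℝ V] {J : V →ₗ[ℝ] H₁} (D : V →ₗ[ℝ] H₂)

/-- In finite dimension the form is nondegenerate as soon as it is positive definite. With
$\gamma=1$, $\mu=0$ this gives Riesz representers with respect to `J`. -/
lemma exists_forall_inner_add_inner_eq (hJ : Function.Injective J) {γ μ : ℝ} (hγ : 0 < γ)
    (hμ : 0 ≤ μ) (φ : Module.Dual ℝ V) :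
    ∃ w, ∀ v, γ * inner ℝ (J w) (J v) + μ * inner ℝ (D w) (D v) = φ v := by
  let B : V →ₗ[ℝ] Module.Dual ℝ V := LinearMap.mk₂ ℝ
    (fun w v => γ * inner ℝ (J w) (J v) + μ * inner ℝ (D w) (D v))
    (fun x y z => by simp only [map_add, inner_add_left]; ring)
    (fun c x y => by simp only [map_smul, real_inner_smul_left, smul_eq_mul]; ring)
    (fun x y z => by simp only [map_add, inner_add_right]; ring)
    (fun c x y => by simp only [map_smul, real_inner_smul_right, smul_eq_mul]; ring)
  have hB : Function.Injective B := by
    rw [injective_iff_map_eq_zero]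
    intro w hw
    have h : γ * inner ℝ (J w) (J w) + μ * inner ℝ (D w) (D w) = 0 := LinearMap.congr_fun hw w
    rw [real_inner_self_eq_norm_sq, real_inner_self_eq_norm_sq] at h
    have h1 : ‖J w‖ ^ 2 = 0 := by
      have h2 := mul_nonneg hμ (sq_nonneg ‖D w‖)
      have h3 := sq_nonneg ‖J w‖
      nlinarith
    exact hJ (by simpa using h1)
  obtain ⟨w, hw⟩ := (LinearMap.injective_iff_surjective_of_finrank_eq_finrank
    (Subspace.dual_finrank_eq (K := ℝ) (V := V)).symm).1 hB φ
  exact ⟨w, fun v => LinearMap.congr_fun hw v⟩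

lemma inner_sum_map_le (hJ : Function.Injective J) {e φ : H₁} {a : ℝ → ℝ} {σ m₁ F : ℝ}
    (hm₁ : 0 < m₁) (ha : ∀ x, m₁ ≤ a x) {g : ℕ → ℝ} {U : ℕ → V} {n : ℕ}
    (hU : LevelEq J D e a σ g φ U n) (hφ : ‖φ‖ ≤ F) :
    inner ℝ (∑ j ∈ Finset.Icc 1 n, g j • (D (U j) - D (U (j - 1))))
      ((1 - σ) • D (U n) + σ • D (U (n - 1))) ≤ F ^ 2 / (4 * m₁) := by
  set X := ∑ j ∈ Finset.Icc 1 n, g j • (U j - U (j - 1)) with hX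
  set w := (1 - σ) • U n + σ • U (n - 1) with hw
  have hDX : ∑ j ∈ Finset.Icc 1 n, g j • (D (U j) - D (U (j - 1))) = D X := by
    simp only [hX, map_sum, map_smul, map_sub]
  have hDw : (1 - σ) • D (U n) + σ • D (U (n - 1)) = D w := by
    simp only [hw, map_add, map_smul]
  rw [hDX, hDw]
  -- `z` is minus the discrete Laplacian of `w`. Testing with it turns the first term into the
  -- gradient pairing and the diffusion term into $a\|Jz\|^2$, which absorbs the source by Young's
  -- inequality.
  obtain ⟨z, hz⟩ := exists_forall_inner_add_inner_eq D hJ one_pos le_rfl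
    ((innerₗ H₂ (D w)).comp D)
  simp only [one_mul, zero_mul, add_zero, LinearMap.comp_apply, innerₗ_apply_apply] at hz
  have h1 := hU z
  rw [real_inner_comm, hz X, ← hz z, real_inner_self_eq_norm_sq] at h1
  have h2 : inner ℝ φ (J z) ≤ F * ‖J z‖ :=
    (real_inner_le_norm _ _).trans (mul_le_mul_of_nonneg_right hφ (norm_nonneg _))
  have h3 : m₁ * ‖J z‖ ^ 2 ≤ a (inner ℝ e (J w)) * ‖J z‖ ^ 2 :=
    mul_le_mul_of_nonneg_right (ha _) (sq_nonneg _)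
  rw [real_inner_comm, le_div_iff₀ (by positivity)]
  nlinarith [sq_nonneg (F - 2 * m₁ * ‖J z‖)]

/-- Stability of the scheme in the energy norm. -/
lemma norm_sq_map_le (hJ : Function.Injective J) {e : H₁} {φ : ℕ → H₁} {a : ℝ → ℝ}
    {σ m₁ F c : ℝ} (hm₁ : 0 < m₁) (ha : ∀ x, m₁ ≤ a x) {g : ℕ → ℕ → ℝ} {U : ℕ → V} {n : ℕ}
    (hσ : σ ≤ 1 / 2) (hc : 0 < c) (hg1 : ∀ i, 1 ≤ i → i ≤ n → c ≤ g i 1)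
    (hmono : ∀ i, i ≤ n → ∀ j, 1 ≤ j → j < i → g i j ≤ g i (j + 1))
    (hlast : ∀ i, i ≤ n → 2 ≤ i → (1 - σ) ^ 2 * g i (i - 1) ≤ (1 - 2 * σ) * g i i)
    (hU : ∀ i, 1 ≤ i → i ≤ n → LevelEq J D e a σ (g i) (φ i) U i)
    (hφ : ∀ i, 1 ≤ i → i ≤ n → ‖φ i‖ ≤ F) :
    ∀ i, i ≤ n → ‖D (U i)‖ ^ 2 ≤ ‖D (U 0)‖ ^ 2 + F ^ 2 / (2 * m₁) / c := by
  intro i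
  induction i using Nat.strong_induction_on with
  | _ i ih =>
    intro hi
    have hQ : 0 ≤ F ^ 2 / (2 * m₁) := by positivity
    rcases Nat.eq_zero_or_pos i with rfl | hi0
    · have := div_nonneg hQ hc.le
      linarith
    have h1 := inner_sum_map_le D hJ hm₁ ha (hU i hi0 hi) (hφ i hi0 hi)
    have h2 := half_sum_le_inner (fun j => D (U j)) hi0 hσ (hc.le.trans (hg1 i hi0 hi))
      (hmono i hi) (hlast i hi)
    have h3 : F ^ 2 / (2 * m₁) = 2 * (F ^ 2 / (4 * m₁)) := by field_simp; ring
    obtain ⟨k, rfl⟩ := Nat.exists_eq_add_of_le' hi0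
    exact le_of_sum_mul_sub_le (y := fun j => ‖D (U j)‖ ^ 2) hc (hg1 _ hi0 hi) (hmono _ hi)
      (by linarith) hQ (fun j _ hj => ih j hj (by omega)) le_rfl

end Linear

/-! ### Unique solvability of one step -/

/-- The scalar map $x\mapsto(e,Jw(x))$, with `w x` solving the problem with coefficient `a x`, is
bounded and Lipschitz, hence has a fixed point. -/
lemma exists_nonlocal_solution [FiniteDimensional ℝ V] {J : V →ₗ[ℝ] H₁} (D : V →ₗ[ℝ] H₂)
    (hJ : Function.Injective J) (e : H₁) {a : ℝ → ℝ} {m₁ L γ : ℝ} (hm₁ : 0 < m₁)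
    (ha : ∀ x, m₁ ≤ a x) (haL : ∀ x y, |a x - a y| ≤ L * |x - y|) (hγ : 0 < γ)
    (ψ : Module.Dual ℝ V) :
    ∃ w, ∀ v, γ * inner ℝ (J w) (J v) + a (inner ℝ e (J w)) * inner ℝ (D w) (D v) = ψ v := by
  obtain ⟨z, hz⟩ := exists_forall_inner_add_inner_eq D hJ one_pos le_rfl ψ
  simp only [one_mul, zero_mul, add_zero] at hz
  choose w hw using fun x => exists_forall_inner_add_inner_eq D hJ hγ (hm₁.le.trans (ha x)) ψ
  have hen : ∀ x, γ * ‖J (w x)‖ ^ 2 + m₁ * ‖D (w x)‖ ^ 2 ≤ ‖J z‖ * ‖J (w x)‖ := by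
    intro x
    have h := hw x (w x)
    rw [← hz, real_inner_self_eq_norm_sq, real_inner_self_eq_norm_sq] at h
    have := mul_le_mul_of_nonneg_right (ha x) (sq_nonneg ‖D (w x)‖)
    linarith [real_inner_le_norm (J z) (J (w x))]
  have hJw : ∀ x, ‖J (w x)‖ ≤ ‖J z‖ / γ := by
    intro x
    rw [le_div_iff₀ hγ]
    rcases (norm_nonneg (J (w x))).eq_or_lt with h | h
    · rw [← h, zero_mul]
      exact norm_nonneg _
    · refine le_of_mul_le_mul_right ?_ h
      nlinarith [hen x, mul_nonneg hm₁.le (sq_nonneg ‖D (w x)‖)]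
  have hDw : ∀ x, ‖D (w x)‖ ^ 2 ≤ ‖J z‖ ^ 2 / γ / m₁ := by
    intro x
    have h1 := mul_le_mul_of_nonneg_left (hJw x) (norm_nonneg (J z))
    have h2 : ‖J z‖ * (‖J z‖ / γ) = ‖J z‖ ^ 2 / γ := by ring
    rw [le_div_iff₀ hm₁]
    nlinarith [hen x, mul_nonneg hγ.le (sq_nonneg ‖J (w x)‖)]
  set P := ‖J z‖ ^ 2 / γ / m₁
  have hP : 0 ≤ P := by positivity
  -- Subtract the two frozen problems, test with the difference, and absorb its gradient by Young's
  -- inequality.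
  have hdiff : ∀ x y, γ * ‖J (w x - w y)‖ ^ 2 ≤ (L * |x - y|) ^ 2 * P / (4 * m₁) := by
    intro x y
    have h1 : γ * ‖J (w x - w y)‖ ^ 2 + a x * ‖D (w x - w y)‖ ^ 2 =
        (a y - a x) * inner ℝ (D (w y)) (D (w x - w y)) := by
      have h2 := hw x (w x - w y)
      have h3 := hw y (w x - w y)
      rw [← real_inner_self_eq_norm_sq, ← real_inner_self_eq_norm_sq]
      nth_rewrite 1 [map_sub J (w x) (w y)]
      nth_rewrite 1 [map_sub D (w x) (w y)]
      rw [inner_sub_left, inner_sub_left]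
      linarith
    have h4 : (a y - a x) * inner ℝ (D (w y)) (D (w x - w y)) ≤
        (L * |x - y|) * (‖D (w y)‖ * ‖D (w x - w y)‖) := by
      refine (le_abs_self _).trans ?_
      rw [abs_mul, abs_sub_comm]
      exact mul_le_mul (haL x y) (abs_real_inner_le_norm _ _) (abs_nonneg _)
        ((abs_nonneg _).trans (haL x y))
    have h5 := mul_le_mul_of_nonneg_right (ha x) (sq_nonneg ‖D (w x - w y)‖)
    have h6 := mul_le_mul_of_nonneg_left (hDw y) (sq_nonneg (L * |x - y|))
    rw [le_div_iff₀ (by positivity)]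
    nlinarith [sq_nonneg (L * |x - y| * ‖D (w y)‖ - 2 * m₁ * ‖D (w x - w y)‖)]
  have hlip : ∀ x y, dist (inner ℝ e (J (w x))) (inner ℝ e (J (w y))) ≤
      ‖e‖ * Real.sqrt (L ^ 2 * P / (4 * m₁) / γ) * dist x y := by
    intro x y
    rw [Real.dist_eq, Real.dist_eq, ← inner_sub_right, ← map_sub, mul_assoc]
    refine (abs_real_inner_le_norm _ _).trans (mul_le_mul_of_nonneg_left ?_ (norm_nonneg _))
    refine le_of_sq_le_sq ?_ (by positivity)
    rw [mul_pow, Real.sq_sqrt (by positivity)]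
    have h1 := hdiff x y
    rw [mul_pow] at h1
    rw [div_mul_eq_mul_div, le_div_iff₀ hγ, mul_comm]
    exact h1.trans_eq (by ring)
  have hcont : Continuous fun x => inner ℝ e (J (w x)) - x :=
    (LipschitzWith.of_dist_le' hlip).continuous.sub continuous_id
  set R := ‖e‖ * (‖J z‖ / γ)
  have hR0 : 0 ≤ R := by positivity
  have hR : ∀ x, |inner ℝ e (J (w x))| ≤ R := fun x =>
    (abs_real_inner_le_norm _ _).trans (mul_le_mul_of_nonneg_left (hJw x) (norm_nonneg _))
  obtain ⟨x, -, hx⟩ := intermediate_value_Icc' (show -R ≤ R by linarith) hcont.continuousOn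
    (show (0 : ℝ) ∈ Set.Icc _ _ from
      ⟨by linarith [(abs_le.1 (hR R)).2], by linarith [(abs_le.1 (hR (-R))).1]⟩)
  refine ⟨w x, fun v => ?_⟩
  rw [sub_eq_zero.1 hx]
  exact hw x v

/-- `hB` says that $\gamma X^2-L\|e\|B\,XY+m_1Y^2$ has negative discriminant. The energy identity
for the difference makes this form nonpositive at $X=\|Jd\|$, $Y=\|Dd\|$. -/
lemma nonlocal_solution_unique {J : V →ₗ[ℝ] H₁} {D : V →ₗ[ℝ] H₂}
    (hJ : Function.Injective J) {e : H₁} {a : ℝ → ℝ} {m₁ L γ B : ℝ} (hm₁ : 0 < m₁)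
    (ha : ∀ x, m₁ ≤ a x) (haL : ∀ x y, |a x - a y| ≤ L * |x - y|)
    (hB : (L * ‖e‖ * B) ^ 2 < 4 * m₁ * γ) {ψ : V → ℝ} {w₁ w₂ : V}
    (h₁ : ∀ v, γ * inner ℝ (J w₁) (J v) + a (inner ℝ e (J w₁)) * inner ℝ (D w₁) (D v) = ψ v)
    (h₂ : ∀ v, γ * inner ℝ (J w₂) (J v) + a (inner ℝ e (J w₂)) * inner ℝ (D w₂) (D v) = ψ v)
    (hw₂ : ‖D w₂‖ ≤ B) : w₁ = w₂ := by
  have hL : 0 ≤ L := by simpa using (abs_nonneg _).trans (haL 1 0)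
  set d := w₁ - w₂ with hd
  have h3 : γ * ‖J d‖ ^ 2 + a (inner ℝ e (J w₁)) * ‖D d‖ ^ 2 =
      (a (inner ℝ e (J w₂)) - a (inner ℝ e (J w₁))) * inner ℝ (D w₂) (D d) := by
    have h4 := h₁ d
    have h5 := h₂ d
    have h6 : inner ℝ (J d) (J d) = inner ℝ (J w₁) (J d) - inner ℝ (J w₂) (J d) := by
      rw [← inner_sub_left, ← map_sub]
    have h7 : inner ℝ (D d) (D d) = inner ℝ (D w₁) (D d) - inner ℝ (D w₂) (D d) := by
      rw [← inner_sub_left, ← map_sub]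
    rw [← real_inner_self_eq_norm_sq, ← real_inner_self_eq_norm_sq, h6, h7]
    linarith
  have h4 : (a (inner ℝ e (J w₂)) - a (inner ℝ e (J w₁))) * inner ℝ (D w₂) (D d) ≤
      L * ‖e‖ * B * ‖J d‖ * ‖D d‖ := by
    have h5 : |a (inner ℝ e (J w₂)) - a (inner ℝ e (J w₁))| ≤ L * (‖e‖ * ‖J d‖) := by
      rw [abs_sub_comm]
      refine (haL _ _).trans (mul_le_mul_of_nonneg_left ?_ hL)
      rw [← inner_sub_right, ← map_sub]
      exact abs_real_inner_le_norm _ _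
    have h6 : |inner ℝ (D w₂) (D d)| ≤ B * ‖D d‖ :=
      (abs_real_inner_le_norm _ _).trans (mul_le_mul_of_nonneg_right hw₂ (norm_nonneg _))
    calc _ ≤ |(a (inner ℝ e (J w₂)) - a (inner ℝ e (J w₁)))| * |inner ℝ (D w₂) (D d)| := by
          rw [← abs_mul]; exact le_abs_self _
      _ ≤ L * (‖e‖ * ‖J d‖) * (B * ‖D d‖) := mul_le_mul h5 h6 (abs_nonneg _) (by positivity)
      _ = _ := by ring
  have h5 := mul_le_mul_of_nonneg_right (ha (inner ℝ e (J w₁))) (sq_nonneg ‖D d‖)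
  have h6 : (4 * m₁ * γ - (L * ‖e‖ * B) ^ 2) * ‖J d‖ ^ 2 ≤ 0 := by
    nlinarith [sq_nonneg (L * ‖e‖ * B * ‖J d‖ - 2 * m₁ * ‖D d‖)]
  have h7 : ‖J d‖ ^ 2 = 0 :=
    le_antisymm (nonpos_of_mul_nonpos_right h6 (sub_pos.2 hB)) (sq_nonneg _)
  have h8 : d = 0 := hJ (by simpa using h7)
  exact sub_eq_zero.1 h8

/-- The equation for `U^n` in terms of `(1 - σ) U^n + σ U^{n-1}`. -/
lemma levelEq_update_iff {J : V →ₗ[ℝ] H₁} {D : V →ₗ[ℝ] H₂} {e φ : H₁} {a : ℝ → ℝ} {σ : ℝ}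
    (hσ : σ < 1) {g : ℕ → ℝ} (U : ℕ → V) {n : ℕ} (hn : 1 ≤ n) (W : V) :
    LevelEq J D e a σ g φ (Function.update U n W) n ↔
      ∀ v, g n / (1 - σ) * inner ℝ (J ((1 - σ) • W + σ • U (n - 1))) (J v) +
        a (inner ℝ e (J ((1 - σ) • W + σ • U (n - 1)))) *
          inner ℝ (D ((1 - σ) • W + σ • U (n - 1))) (D v) =
        inner ℝ (φ - J (∑ j ∈ Finset.Icc 1 (n - 1), g j • (U j - U (j - 1)) -
          (g n / (1 - σ)) • U (n - 1))) (J v) := by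
  obtain ⟨m, rfl⟩ := Nat.exists_eq_add_of_le' hn
  have hσ' : 1 - σ ≠ 0 := by linarith
  -- With $w=(1-\sigma)W+\sigma U^m$ one has $W-U^m=(w-U^m)/(1-\sigma)$.
  have hsum : ∑ j ∈ Finset.Icc 1 (m + 1), g j • (Function.update U (m + 1) W j -
      Function.update U (m + 1) W (j - 1)) = (g (m + 1) / (1 - σ)) • ((1 - σ) • W + σ • U m) +
      (∑ j ∈ Finset.Icc 1 m, g j • (U j - U (j - 1)) - (g (m + 1) / (1 - σ)) • U m) := by
    rw [Finset.sum_Icc_succ_top (by omega), Nat.add_sub_cancel, Function.update_self,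
      Function.update_of_ne (by omega), Finset.sum_congr rfl fun j hj => ?_]
    · have h : g (m + 1) = g (m + 1) / (1 - σ) * (1 - σ) := (div_mul_cancel₀ _ hσ').symm
      generalize g (m + 1) / (1 - σ) = γ at h
      rw [h]
      module
    · rw [Finset.mem_Icc] at hj
      rw [Function.update_of_ne (by omega), Function.update_of_ne (by omega)]
  unfold LevelEq
  rw [hsum, Nat.add_sub_cancel, Function.update_self, Function.update_of_ne (by omega)]
  refine forall_congr' fun v => ?_
  rw [map_add, map_smul J (g (m + 1) / (1 - σ)), inner_add_left, inner_sub_left,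
    real_inner_smul_left]
  constructor <;> intro h <;> linarith

/-- Unique solvability of one step of the scheme, given a bound for its solutions. -/
lemma existsUnique_levelEq [FiniteDimensional ℝ V] {J : V →ₗ[ℝ] H₁} (D : V →ₗ[ℝ] H₂)
    (hJ : Function.Injective J) {e φ : H₁} {a : ℝ → ℝ} {σ m₁ L B : ℝ} (hm₁ : 0 < m₁)
    (ha : ∀ x, m₁ ≤ a x) (haL : ∀ x y, |a x - a y| ≤ L * |x - y|) (hσ : σ < 1)
    {g : ℕ → ℝ} {U : ℕ → V} {n : ℕ} (hn : 1 ≤ n) (hg : 0 < g n)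
    (hB : (L * ‖e‖ * B) ^ 2 < 4 * m₁ * (g n / (1 - σ)))
    (hbound : ∀ W, LevelEq J D e a σ g φ (Function.update U n W) n →
      ‖D ((1 - σ) • W + σ • U (n - 1))‖ ≤ B) :
    ∃! W, LevelEq J D e a σ g φ (Function.update U n W) n := by
  have hσ' : 1 - σ ≠ 0 := by linarith
  obtain ⟨w, hw⟩ := exists_nonlocal_solution D hJ e hm₁ ha haL
    (div_pos hg (sub_pos.2 hσ)) ((innerₗ H₁ (φ - J (∑ j ∈ Finset.Icc 1 (n - 1),
      g j • (U j - U (j - 1)) - (g n / (1 - σ)) • U (n - 1)))).comp J)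
  refine ⟨(1 - σ)⁻¹ • (w - σ • U (n - 1)), ?_, fun W hW => ?_⟩
  · refine (levelEq_update_iff hσ U hn _).2 ?_
    rwa [smul_inv_smul₀ hσ', sub_add_cancel]
  · have h := nonlocal_solution_unique hJ hm₁ ha haL hB hw ((levelEq_update_iff hσ U hn W).1 hW)
      (hbound W hW)
    rw [h, add_sub_cancel_right, inv_smul_smul₀ hσ']

/-! ### The finite element space -/

section FiniteElement

variable {d : ℕ} {Ω : Set (Space d)}

namespace Mesh

lemma exists_full_face (K : Mesh Ω) {x : Space d} (hx : x ∈ K.complex.space) :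
    ∃ t ∈ K.complex.faces, t.card = d + 1 ∧ x ∈ convexHull ℝ (t : Set (Space d)) := by
  obtain ⟨s, hs, hxs⟩ := Geometry.SimplicialComplex.mem_space_iff.1 hx
  obtain ⟨t, ht, hst, hc⟩ := K.pure s hs
  exact ⟨t, ht, hc, convexHull_mono (Finset.coe_subset.2 hst) hxs⟩

lemma isClosed_space (K : Mesh Ω) : IsClosed K.complex.space :=
  K.finite.isClosed_biUnion fun s _ => (s.finite_toSet.isCompact_convexHull ℝ).isClosed

/-- The union of the boundaries of the elements. -/
def skeleton (K : Mesh Ω) : Set (Space d) :=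
  ⋃ s ∈ K.complex.faces, frontier (convexHull ℝ (s : Set (Space d)))

/-- Frontiers of convex sets are null, for faces of every dimension. -/
lemma volume_skeleton (K : Mesh Ω) : volume K.skeleton = 0 :=
  (measure_biUnion_null_iff K.finite.countable).2 fun s _ =>
    (convex_convexHull ℝ (s : Set (Space d))).addHaar_frontier volume

lemma ae_notMem_skeleton (K : Mesh Ω) : ∀ᵐ x ∂(volume.restrict Ω), x ∉ K.skeleton :=
  ae_restrict_of_ae (measure_eq_zero_iff_ae_notMem.1 K.volume_skeleton)

lemma exists_mem_interior (K : Mesh Ω) {x : Space d} (hx : x ∈ K.complex.space)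
    (hx' : x ∉ K.skeleton) : ∃ t ∈ K.complex.faces, t.card = d + 1 ∧
      x ∈ interior (convexHull ℝ (t : Set (Space d))) := by
  obtain ⟨t, ht, hc, hxt⟩ := K.exists_full_face hx
  refine ⟨t, ht, hc, ?_⟩
  by_contra h
  exact hx' (Set.mem_biUnion ht ⟨subset_closure hxt, h⟩)

end Mesh

lemma hasFDerivAt_affineMap (A : Space d →ᵃ[ℝ] ℝ) (x : Space d) :
    HasFDerivAt A (LinearMap.toContinuousLinearMap A.linear) x := by
  have h := ((LinearMap.toContinuousLinearMap A.linear).hasFDerivAt (x := x)).add_const (A 0)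
  refine h.congr_of_eventuallyEq (Filter.Eventually.of_forall fun y => ?_)
  exact congrFun A.decomp y

/-- Off the skeleton a point lies in the interior of an element, where `u` is affine, or in the open
complement of the mesh region, where `u` vanishes. Finitely many elements give the uniform bound. -/
lemma exists_hasFDerivAt_of_mem_feSpace {K : Mesh Ω} {u : Space d → ℝ} (hu : u ∈ feSpace K) :
    ∃ C : ℝ, ∀ x ∉ K.skeleton, ∃ φ : Space d →L[ℝ] ℝ, ‖φ‖ ≤ C ∧ HasFDerivAt u φ x := by
  have h : ∀ s : Finset (Space d), ∃ A : Space d →ᵃ[ℝ] ℝ, s ∈ K.complex.faces → s.card = d + 1 →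
      Set.EqOn u A (convexHull ℝ (s : Set (Space d))) := by
    intro s
    by_cases hs : s ∈ K.complex.faces ∧ s.card = d + 1
    · obtain ⟨A, hA⟩ := hu.2.2.2 s hs.1 hs.2
      exact ⟨A, fun _ _ => hA⟩
    · exact ⟨0, fun h1 h2 => (hs ⟨h1, h2⟩).elim⟩
  choose A hA using h
  let B := fun s => ‖LinearMap.toContinuousLinearMap (A s).linear‖
  obtain ⟨C, hC⟩ := (K.finite.image B).bddAbove
  refine ⟨max C 0, fun x hx => ?_⟩
  by_cases hxK : x ∈ K.complex.space
  · obtain ⟨t, ht, hc, hxt⟩ := K.exists_mem_interior hxK hx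
    refine ⟨_, (hC (Set.mem_image_of_mem B ht)).trans (le_max_left _ _),
      (hasFDerivAt_affineMap (A t) x).congr_of_eventuallyEq ?_⟩
    filter_upwards [mem_interior_iff_mem_nhds.1 hxt] with y hy using hA t ht hc hy
  · refine ⟨0, by simp, (hasFDerivAt_const (0 : ℝ) x).congr_of_eventuallyEq ?_⟩
    filter_upwards [K.isClosed_space.isOpen_compl.mem_nhds hxK] with y hy using hu.2.2.1 y hy

lemma differentiableAt_of_mem_feSpace {K : Mesh Ω} {u : Space d → ℝ} (hu : u ∈ feSpace K)
    {x : Space d} (hx : x ∉ K.skeleton) : DifferentiableAt ℝ u x := by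
  obtain ⟨C, hC⟩ := exists_hasFDerivAt_of_mem_feSpace hu
  obtain ⟨φ, -, h⟩ := hC x hx
  exact h.differentiableAt

instance finiteDimensional_feSpace (K : Mesh Ω) : FiniteDimensional ℝ (feSpace K) := by
  classical
  let S : Finset (Space d) := K.finite.toFinset.biUnion id
  -- Nodal values determine the function: an affine map vanishing at the vertices vanishes on their
  -- hull.
  let Φ : feSpace K →ₗ[ℝ] (S → ℝ) :=
    { toFun := fun u x => (u : Space d → ℝ) x
      map_add' := fun _ _ => rfl
      map_smul' := fun _ _ => rfl }
  refine FiniteDimensional.of_injective Φ ((injective_iff_map_eq_zero Φ).2 fun u hu => ?_)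
  refine Subtype.ext (funext fun x => ?_)
  by_cases hx : x ∈ K.complex.space
  · obtain ⟨t, ht, hc, hxt⟩ := K.exists_full_face hx
    obtain ⟨A, hA⟩ := u.2.2.2.2 t ht hc
    have h : convexHull ℝ (t : Set (Space d)) ⊆ A ⁻¹' {0} := by
      refine convexHull_min (fun y hy => ?_) ((convex_singleton (0 : ℝ)).affine_preimage A)
      have hyS : y ∈ S := Finset.mem_biUnion.2 ⟨t, K.finite.mem_toFinset.2 ht, hy⟩
      rw [Set.mem_preimage, ← hA (subset_convexHull ℝ _ hy)]
      exact congrFun hu ⟨y, hyS⟩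
    exact (hA hxt).trans (h hxt)
  · exact u.2.2.2.1 x hx

lemma isFiniteMeasure_restrict_of_isBounded (hΩb : Bornology.IsBounded Ω) :
    IsFiniteMeasure (volume.restrict Ω) :=
  isFiniteMeasure_restrict.2 hΩb.measure_lt_top.ne

lemma memLp_of_mem_feSpace (hΩ : IsOpen Ω) (hΩb : Bornology.IsBounded Ω) {K : Mesh Ω}
    {u : Space d → ℝ} (hu : u ∈ feSpace K) : MemLp u 2 (volume.restrict Ω) := by
  have := isFiniteMeasure_restrict_of_isBounded hΩb
  obtain ⟨C, hC⟩ := hΩb.isCompact_closure.exists_bound_of_continuousOn hu.1.continuousOn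
  refine MemLp.of_bound hu.1.aestronglyMeasurable C ?_
  filter_upwards [ae_restrict_mem hΩ.measurableSet] with x hx using hC x (subset_closure hx)

lemma memLp_gradient_of_mem_feSpace (hΩb : Bornology.IsBounded Ω) {K : Mesh Ω}
    {u : Space d → ℝ} (hu : u ∈ feSpace K) : MemLp (gradient u) 2 (volume.restrict Ω) := by
  have := isFiniteMeasure_restrict_of_isBounded hΩb
  obtain ⟨C, hC⟩ := exists_hasFDerivAt_of_mem_feSpace hu
  have hm : Measurable (gradient u) :=
    (InnerProductSpace.toDual ℝ (Space d)).symm.continuous.measurable.comp (measurable_fderiv ℝ u)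
  refine MemLp.of_bound hm.aestronglyMeasurable C ?_
  filter_upwards [K.ae_notMem_skeleton] with x hx
  obtain ⟨φ, hφ, h⟩ := hC x hx
  rwa [gradient, LinearIsometryEquiv.norm_map, h.fderiv]

lemma gradient_add_ae {K : Mesh Ω} (u v : feSpace K) :
    gradient ((u + v : feSpace K) : Space d → ℝ) =ᵐ[volume.restrict Ω]
      gradient (u : Space d → ℝ) + gradient (v : Space d → ℝ) := by
  filter_upwards [K.ae_notMem_skeleton] with x hx
  have h := fderiv_add (differentiableAt_of_mem_feSpace u.2 hx)
    (differentiableAt_of_mem_feSpace v.2 hx)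
  rw [Pi.add_apply, gradient, gradient, gradient, Submodule.coe_add, h, map_add]

lemma gradient_smul_ae {K : Mesh Ω} (c : ℝ) (u : feSpace K) :
    gradient ((c • u : feSpace K) : Space d → ℝ) =ᵐ[volume.restrict Ω]
      c • gradient (u : Space d → ℝ) := by
  filter_upwards [K.ae_notMem_skeleton] with x hx
  have h := fderiv_const_smul (differentiableAt_of_mem_feSpace u.2 hx) c
  rw [Pi.smul_apply, gradient, gradient, Submodule.coe_smul, h, map_smul]

/-- The class in `L²(Ω)` of a finite element function. -/
noncomputable def toL2 (hΩ : IsOpen Ω) (hΩb : Bornology.IsBounded Ω) (K : Mesh Ω) :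
    feSpace K →ₗ[ℝ] Lp ℝ 2 (volume.restrict Ω) where
  toFun u := (memLp_of_mem_feSpace hΩ hΩb u.2).toLp u
  map_add' _ _ := rfl
  map_smul' _ _ := rfl

/-- The class in `L²(Ω)` of the gradient of a finite element function. -/
noncomputable def gradL2 (hΩb : Bornology.IsBounded Ω) (K : Mesh Ω) :
    feSpace K →ₗ[ℝ] Lp (Space d) 2 (volume.restrict Ω) where
  toFun u := (memLp_gradient_of_mem_feSpace hΩb u.2).toLp (gradient (u : Space d → ℝ))
  map_add' u v := by
    have hu := memLp_gradient_of_mem_feSpace hΩb u.2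
    have hv := memLp_gradient_of_mem_feSpace hΩb v.2
    have h := MemLp.toLp_congr (memLp_gradient_of_mem_feSpace hΩb (u + v).2) (hu.add hv)
      (gradient_add_ae u v)
    exact h.trans (MemLp.toLp_add hu hv)
  map_smul' c u := by
    have hu := memLp_gradient_of_mem_feSpace hΩb u.2
    have h := MemLp.toLp_congr (memLp_gradient_of_mem_feSpace hΩb (c • u).2) (hu.const_smul c)
      (gradient_smul_ae c u)
    exact h.trans (MemLp.toLp_const_smul c hu)

lemma coeFn_toL2 (hΩ : IsOpen Ω) (hΩb : Bornology.IsBounded Ω) {K : Mesh Ω} (u : feSpace K) :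
    toL2 hΩ hΩb K u =ᵐ[volume.restrict Ω] (u : Space d → ℝ) :=
  (memLp_of_mem_feSpace hΩ hΩb u.2).coeFn_toLp

lemma coeFn_gradL2 (hΩb : Bornology.IsBounded Ω) {K : Mesh Ω} (u : feSpace K) :
    gradL2 hΩb K u =ᵐ[volume.restrict Ω] gradient (u : Space d → ℝ) :=
  (memLp_gradient_of_mem_feSpace hΩb u.2).coeFn_toLp

/-- The constant function `1` in `L²(Ω)`. -/
noncomputable def oneL2 (hΩb : Bornology.IsBounded Ω) : Lp ℝ 2 (volume.restrict Ω) :=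
  haveI := isFiniteMeasure_restrict_of_isBounded hΩb
  (memLp_const (1 : ℝ)).toLp (fun _ => (1 : ℝ))

lemma inner_toL2 (hΩ : IsOpen Ω) (hΩb : Bornology.IsBounded Ω) (K : Mesh Ω)
    (f : Lp ℝ 2 (volume.restrict Ω)) (v : feSpace K) :
    inner ℝ f (toL2 hΩ hΩb K v) = l2Inner Ω f v := by
  rw [L2.inner_def]
  refine integral_congr_ae ?_
  filter_upwards [coeFn_toL2 hΩ hΩb v] with x hx
  rw [hx, RCLike.inner_apply, conj_trivial, mul_comm]

lemma inner_toL2_toL2 (hΩ : IsOpen Ω) (hΩb : Bornology.IsBounded Ω) (K : Mesh Ω)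
    (u v : feSpace K) : inner ℝ (toL2 hΩ hΩb K u) (toL2 hΩ hΩb K v) = l2Inner Ω u v := by
  rw [inner_toL2]
  refine integral_congr_ae ?_
  filter_upwards [coeFn_toL2 hΩ hΩb u] with x hx
  rw [hx]

lemma inner_oneL2 (hΩ : IsOpen Ω) (hΩb : Bornology.IsBounded Ω) (K : Mesh Ω)
    (u : feSpace K) : inner ℝ (oneL2 hΩb) (toL2 hΩ hΩb K u) = totalMass Ω u := by
  have := isFiniteMeasure_restrict_of_isBounded hΩb
  rw [inner_toL2]
  refine integral_congr_ae ?_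
  filter_upwards [(memLp_const (μ := volume.restrict Ω) (p := 2) (1 : ℝ)).coeFn_toLp] with x hx
  simp only [oneL2, hx, one_mul]

lemma inner_gradL2 (hΩb : Bornology.IsBounded Ω) (K : Mesh Ω) (u v : feSpace K) :
    inner ℝ (gradL2 hΩb K u) (gradL2 hΩb K v) = gradInner Ω u v := by
  rw [L2.inner_def]
  refine integral_congr_ae ?_
  filter_upwards [coeFn_gradL2 hΩb u, coeFn_gradL2 hΩb v] with x hx hy
  rw [hx, hy]

lemma norm_gradL2 (hΩb : Bornology.IsBounded Ω) (K : Mesh Ω) (u : feSpace K) :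
    ‖gradL2 hΩb K u‖ = gradNorm Ω u := by
  rw [gradNorm, ← inner_gradL2 hΩb, real_inner_self_eq_norm_sq, Real.sqrt_sq (norm_nonneg _)]

/-- Continuous functions equal almost everywhere on an open set agree there; outside $\Omega$ both
vanish. -/
lemma toL2_injective (hΩ : IsOpen Ω) (hΩb : Bornology.IsBounded Ω) (K : Mesh Ω) :
    Function.Injective (toL2 hΩ hΩb K) := by
  intro u v huv
  have h := (MemLp.toLp_eq_toLp_iff (memLp_of_mem_feSpace hΩ hΩb u.2)
    (memLp_of_mem_feSpace hΩ hΩb v.2)).1 huv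
  have h' := Measure.eqOn_open_of_ae_eq h hΩ u.2.1.continuousOn v.2.1.continuousOn
  refine Subtype.ext (funext fun x => ?_)
  by_cases hx : x ∈ Ω
  · exact h' hx
  · rw [u.2.2.1 x hx, v.2.2.1 x hx]

end FiniteElement

/-! ### The finite element scheme as an instance of the abstract one. -/

section Scheme

variable {d : ℕ} {Ω : Set (Space d)}

lemma schemeAt_congr {K : Mesh Ω} {T r α : ℝ} {N n : ℕ} {a : ℝ → ℝ}
    {f : ℝ → Lp ℝ 2 (volume.restrict Ω)} {U U' : ℕ → Space d → ℝ} (h : ∀ j, j ≤ n → U j = U' j) :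
    SchemeAt K T r α N a f U n ↔ SchemeAt K T r α N a f U' n := by
  have h1 : discreteCaputo T r α N U n = discreteCaputo T r α N U' n := by
    refine Finset.sum_congr rfl fun j hj => ?_
    rw [Finset.mem_Icc] at hj
    rw [h j hj.2, h (j - 1) (by omega)]
  have h2 : weightedLevel α U n = weightedLevel α U' n := by
    rw [weightedLevel, weightedLevel, h n le_rfl, h (n - 1) (by omega)]
  rw [SchemeAt, SchemeAt, h1, h2]

lemma schemeAt_iff_levelEq (hΩ : IsOpen Ω) (hΩb : Bornology.IsBounded Ω) (K : Mesh Ω)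
    (T r α : ℝ) (N n : ℕ) (a : ℝ → ℝ) (f : ℝ → Lp ℝ 2 (volume.restrict Ω)) (U : ℕ → feSpace K) :
    SchemeAt K T r α N a f (fun j => U j) n ↔
      LevelEq (toL2 hΩ hΩb K) (gradL2 hΩb K) (oneL2 hΩb) a (α / 2) (gCoeff T r α N n)
        (f (offsetTime T r α N n)) U n := by
  have h1 : discreteCaputo T r α N (fun j => U j) n =
      ((∑ j ∈ Finset.Icc 1 n, gCoeff T r α N n j • (U j - U (j - 1)) : feSpace K) :
        Space d → ℝ) := by
    rw [discreteCaputo, Submodule.coe_sum]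
    rfl
  have h2 : weightedLevel α (fun j => (U j : Space d → ℝ)) n =
      (((1 - α / 2) • U n + (α / 2) • U (n - 1) : feSpace K) : Space d → ℝ) := rfl
  rw [SchemeAt, LevelEq, h1, h2, Subtype.forall]
  refine forall₂_congr fun v hv => ?_
  rw [inner_toL2_toL2, inner_oneL2, inner_gradL2, inner_toL2]

end Scheme

lemma le_of_le_stepThreshold {d : ℕ} {Ω : Set (Space d)} {T r α : ℝ} {N n : ℕ} {m₁ L C : ℝ}
    {U₀ : Space d → ℝ} (hα1 : α < 1) (hm₁ : 0 < m₁) (hL : 0 ≤ L) (hC : 0 < C) (hn : 1 ≤ n)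
    (hτ : 0 < timeStep T r N n) (hg : 0 < gCoeff T r α N n n)
    (h : ENNReal.ofReal (timeStep T r N n) ≤ stepThreshold Ω T r α N m₁ L C U₀ n) :
    (L * C * (C * (1 + gradNorm Ω U₀)) * (1 - α)) ^ 2 ≤
      2 * m₁ * (gCoeff T r α N n n / (1 - α / 2)) := by
  have hσ : 0 < 1 - α / 2 := by linarith
  -- For $L=0$ the threshold has a zero denominator, so its hypothesis cannot be used; the claim is
  -- then trivial.
  rcases hL.eq_or_lt with rfl | hL
  · rw [zero_mul, zero_mul, zero_mul, zero_pow two_ne_zero]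
    positivity
  have hab : aCoeff T r α N n n + bCoeff T r α N n (n - 1) =
      timeStep T r N n * gCoeff T r α N n n := by
    rw [gCoeff_self hn, mul_inv_cancel_left₀ hτ.ne']
  have hG : 0 ≤ gradNorm Ω U₀ := Real.sqrt_nonneg _
  have hα : 0 < 1 - α := by linarith
  rw [stepThreshold, hab, show 2 * (α / 2) = α by ring,
    ← ENNReal.ofReal_div_of_pos (by positivity), ENNReal.ofReal_le_ofReal_iff (by positivity),
    le_div_iff₀ (by positivity)] at h
  rw [← mul_div_assoc, le_div_iff₀ hσ]
  refine le_of_mul_le_mul_left ?_ hτ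
  linarith

end NonlocalDiffusion

/-! ### Choice of the constant and conclusion. -/

open NonlocalDiffusion in
theorem theoremt1 {d : ℕ} (hd : d = 1 ∨ d = 2)
    (Ω : Set (NonlocalDiffusion.Space d)) (hΩ : IsOpen Ω) (hΩb : Bornology.IsBounded Ω)
    (T : ℝ) (hT : 0 < T) (α : ℝ) (hα0 : 0 < α) (hα1 : α < 1) (r : ℝ) (hr : 1 ≤ r)
    (m₁ : ℝ) (hm₁ : 0 < m₁) (F : ℝ) :
    ∃ C : ℝ, 0 < C ∧
      ∀ (m₂ L : ℝ) (a : ℝ → ℝ), (∀ x, m₁ ≤ a x ∧ a x ≤ m₂) →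
        (∀ x y, |a x - a y| ≤ L * |x - y|) →
      ∀ (f : ℝ → MeasureTheory.Lp ℝ 2 (MeasureTheory.volume.restrict Ω))
        (K : NonlocalDiffusion.Mesh Ω) (N n : ℕ), 1 ≤ n → n ≤ N →
        (∀ j, 1 ≤ j → j ≤ n → ‖f (NonlocalDiffusion.offsetTime T r α N j)‖ ≤ F) →
      ∀ U : ℕ → NonlocalDiffusion.Space d → ℝ,
        (∀ j, j < n → U j ∈ NonlocalDiffusion.feSpace K) →
        (∀ j, 1 ≤ j → j < n → NonlocalDiffusion.SchemeAt K T r α N a f U j) →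
        ENNReal.ofReal (NonlocalDiffusion.timeStep T r N n) ≤
          NonlocalDiffusion.stepThreshold Ω T r α N m₁ L C (U 0) n →
        ∃! W : NonlocalDiffusion.Space d → ℝ, W ∈ NonlocalDiffusion.feSpace K ∧
          NonlocalDiffusion.SchemeAt K T r α N a f (Function.update U n W) n := by
  have hΓ : 0 < Real.Gamma (1 - α) := Real.Gamma_pos_of_pos (by linarith)
  have hα : 0 < 1 - α := by linarith
  have hc : 0 < 1 / Real.Gamma (1 - α) * T ^ (-α) := by positivity
  set c := 1 / Real.Gamma (1 - α) * T ^ (-α)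
  set κ := F ^ 2 / (2 * m₁) / c
  have hκ : 0 ≤ κ := by positivity
  -- `κ` is the increment in the stability bound. Dividing by $1-\alpha=1-2\sigma$ cancels that
  -- factor in the threshold, where $C$ enters as $C\cdot C$; hence $C=1+s$ with $C^2\ge s$.
  set s := ‖oneL2 hΩb‖ * Real.sqrt (1 + κ) / (1 - α)
  have hs : 0 ≤ s := by positivity
  refine ⟨1 + s, by linarith, fun m₂ L a ha haL f K N n hn hnN hf U hU hUs hstep => ?_⟩
  have hN : 0 < N := by omega
  have hL : 0 ≤ L := by simpa using (abs_nonneg _).trans (haL 1 0)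
  have hg : 0 < gCoeff T r α N n n := by
    have h : ∀ m, 1 ≤ m → m ≤ n → c ≤ gCoeff T r α N n m := by
      intro m hm
      induction m, hm using Nat.le_induction with
      | base => exact fun _ => rpow_le_gCoeff_one hT hr hα0 hα1 hn hnN
      | succ m hm ih =>
        exact fun h => (ih (by omega)).trans (gCoeff_mono hT hr hα0 hα1 hN hm (by omega))
    exact hc.trans_le (h n hn le_rfl)
  have hthr := le_of_le_stepThreshold hα1 hm₁ hL (by linarith) hn (timeStep_pos hT hr hN hn) hg
    hstep
  classical
  -- Membership is known only below level `n`. The default `0` is harmless, since level `n` is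
  -- overwritten and later levels never enter.
  let U' : ℕ → feSpace K := fun j => if h : U j ∈ feSpace K then ⟨U j, h⟩ else 0
  have hU' : ∀ j, j < n → (U' j : Space d → ℝ) = U j := fun j hj => by
    simp only [U', dif_pos (hU j hj)]
  have hupd : ∀ (W : feSpace K) j, j ≤ n →
      ((Function.update U' n W j : feSpace K) : Space d → ℝ) = Function.update U n W j := by
    intro W j hj
    rcases hj.eq_or_lt with rfl | hj
    · rw [Function.update_self, Function.update_self]
    · rw [Function.update_of_ne hj.ne, Function.update_of_ne hj.ne, hU' j hj]
  have hiff : ∀ W : feSpace K, SchemeAt K T r α N a f (Function.update U n W) n ↔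
      LevelEq (toL2 hΩ hΩb K) (gradL2 hΩb K) (oneL2 hΩb) a (α / 2) (gCoeff T r α N n)
        (f (offsetTime T r α N n)) (Function.update U' n W) n := fun W => by
    rw [← schemeAt_iff_levelEq]
    exact schemeAt_congr fun j hj => (hupd W j hj).symm
  set G := gradNorm Ω (U 0)
  have hG : 0 ≤ G := Real.sqrt_nonneg _
  have hB : (L * ‖oneL2 hΩb‖ * (Real.sqrt (1 + κ) * (1 + G))) ^ 2 <
      4 * m₁ * (gCoeff T r α N n n / (1 - α / 2)) := by
    have hpos : 0 < m₁ * (gCoeff T r α N n n / (1 - α / 2)) :=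
      mul_pos hm₁ (div_pos hg (by linarith))
    -- Strictness comes from the factor $2$ in the threshold against the $4$ needed for uniqueness.
    refine lt_of_le_of_lt (le_trans ?_ hthr) (by linarith)
    refine pow_le_pow_left₀ (by positivity) ?_ 2
    have h1 : s * (1 - α) = ‖oneL2 hΩb‖ * Real.sqrt (1 + κ) := div_mul_cancel₀ _ hα.ne'
    have h2 : ‖oneL2 hΩb‖ * Real.sqrt (1 + κ) ≤ (1 + s) * (1 + s) * (1 - α) := by
      rw [← h1]
      exact mul_le_mul_of_nonneg_right (by nlinarith) hα.le
    calc _ = L * (1 + G) * (‖oneL2 hΩb‖ * Real.sqrt (1 + κ)) := by ring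
      _ ≤ L * (1 + G) * ((1 + s) * (1 + s) * (1 - α)) :=
        mul_le_mul_of_nonneg_left h2 (by positivity)
      _ = _ := by ring
  have hbound : ∀ W, LevelEq (toL2 hΩ hΩb K) (gradL2 hΩb K) (oneL2 hΩb) a (α / 2)
      (gCoeff T r α N n) (f (offsetTime T r α N n)) (Function.update U' n W) n →
      ‖gradL2 hΩb K ((1 - α / 2) • W + (α / 2) • U' (n - 1))‖ ≤
        Real.sqrt (1 + κ) * (1 + G) := by
    intro W hW
    have hsq := norm_sq_map_le (gradL2 hΩb K) (toL2_injective hΩ hΩb K)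
      (φ := fun i => f (offsetTime T r α N i)) hm₁ (fun x => (ha x).1)
      (g := gCoeff T r α N) (U := Function.update U' n W) (n := n) (F := F)
      (by linarith : α / 2 ≤ 1 / 2) hc
      (fun i hi hin => rpow_le_gCoeff_one hT hr hα0 hα1 hi (hin.trans hnN))
      (fun i _ j hj hji => gCoeff_mono hT hr hα0 hα1 hN hj hji)
      (fun i _ hi => by
        rw [show 2 * (α / 2) = α by ring]
        exact gCoeff_pred_le hT hr hα0 hα1 hN hi)
      (fun i hi hin => by
        rcases hin.eq_or_lt with rfl | hin
        · exact hW
        · rw [← schemeAt_iff_levelEq]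
          refine (schemeAt_congr fun j hj => ?_).1 (hUs i hi hin)
          rw [hupd W j (by omega), Function.update_of_ne (by omega)])
      (fun i hi hin => hf i hi hin)
    have h0 : ‖gradL2 hΩb K (Function.update U' n W 0)‖ = G := by
      rw [norm_gradL2, hupd W 0 (Nat.zero_le _), Function.update_of_ne (by omega)]
    have hle : ∀ i, i ≤ n → ‖gradL2 hΩb K (Function.update U' n W i)‖ ≤
        Real.sqrt (1 + κ) * (1 + G) := by
      intro i hi
      refine le_of_sq_le_sq ((hsq i hi).trans ?_) (by positivity)
      -- What remains is $G^2+\kappa\le(1+\kappa)(1+G)^2$.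
      rw [mul_pow, Real.sq_sqrt (by linarith), h0]
      nlinarith [mul_nonneg hκ hG, mul_nonneg hκ (sq_nonneg G)]
    have h1 := hle n le_rfl
    have h2 := hle (n - 1) (by omega)
    rw [Function.update_self] at h1
    rw [Function.update_of_ne (by omega)] at h2
    rw [map_add, map_smul, map_smul]
    refine (norm_add_le _ _).trans ?_
    rw [norm_smul, norm_smul, Real.norm_of_nonneg (by linarith : (0 : ℝ) ≤ 1 - α / 2),
      Real.norm_of_nonneg (by linarith : (0 : ℝ) ≤ α / 2)]
    nlinarith
  obtain ⟨W, hW, hWu⟩ := existsUnique_levelEq (gradL2 hΩb K) (toL2_injective hΩ hΩb K) hm₁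
    (fun x => (ha x).1) haL (by linarith : α / 2 < 1) hn hg hB hbound
  exact ⟨W, ⟨W.2, (hiff W).2 hW⟩, fun W₁ hW₁ =>
    congrArg Subtype.val (hWu ⟨W₁, hW₁.1⟩ ((hiff ⟨W₁, hW₁.1⟩).1 hW₁.2))⟩
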